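/- Let $X,Y$ be real Hilbert spaces, $A:X\to Y$ a bounded linear operator, $\bar x\in X$ and $\bar y=A\bar x$. For a Hilbert space $H$, let $\Gamma_0(H)$ be the set of proper, convex, lower semicontinuous functions $H\to(-\infty,+\infty]$. For $f:H\to[-\infty,+\infty]$ write $f^*(v)=\sup_{x}\{\langle x,v\rangle-f(x)\}$, and for $f\in\Gamma_0(H)$ let $\partial f$ be its convex subdifferential and $\operatorname{prox}_f(x)=\operatorname{argmin}_{x'}\{f(x')+\tfrac12\|x'-x\|^2\}$. Write $(f\# g)(x)=\inf_{x'}\{f(x')+g(x-x')\}$. A function $f\in\Gamma_0(H)$ is $\sigma$-strongly convex if $f-\tfrac{\sigma}{2}\|\cdot\|^2\in\Gamma_0(H)$. Assume: (AR) $R\in\Gamma_0(X)$ is $\sigma_R$-strongly convex with $\sigma_R>0$, and $R(\bar x)<+\infty$. (AD) $D:Y\times Y\to[0,+\infty]$ satisfies $D(u;y)=0\iff u=y$. For every $y\in Y$, $D_y:=D(\cdot;y)=\psi_y\#\phi_y$, where $\phi_y\in\Gamma_0(Y)$ and $\psi_y=J_y+\tfrac{\sigma_\psi}{2}\|\cdot\|^2$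 with $J_y\in\Gamma_0(Y)$ and $\sigma_\psi>0$ independent of $y$. The function $D_{\bar y}$ is coercive, i.e. $D_{\bar y}(u)\to+\infty$ as $\|u\|\to+\infty$. Moreover $D_{\bar y}$ is $p$-well conditioned for some $p\in[1,+\infty)$ with modulus $\bar m$: $\bar m\in\Gamma_0(\mathbb R)$ is nonnegative and even, $\bar m(t)=0$ only if $t=0$, $\bar m(\|u-\bar y\|)\le D_{\bar y}(u)$ for all $u\in Y$, and there are $\varepsilon,\gamma>0$ with $\bar m(t)\ge\frac{\gamma}{p}|t|^p$ for $|t|<\varepsilon$. Let $(\lambda_n)_{n\in\mathbb N}$ be a nonincreasing sequence in $(0,+\infty)$ converging to $0$ and belonging to $\ell^{1/(p-1)}(\mathbb N)$, where $1/(p-1)=\infty$ if $p=1$. Let $L=\|A\|^2/\sigma_R+\lambda_0/\sigma_\psi$ and $\tau\in(0,1/L]$. Let $u_0\in Y$ and let $(x_n,w_n,u_n)$ be generated by the (3-D) method with exact data $\bar y$: for all $n\in\mathbb N$, $$x_n=\nabla R^*(-A^*u_n),\qquad w_{n+1}=u_n+\tau Ax_n-\tau\nabla\psi_{\bar y}^*(\lambda_nu_n),\qquad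 u_{n+1}=w_{n+1}-\tau\operatorname{prox}_{(\tau\lambda_n)^{-1}\phi_{\bar y}}(\tau^{-1}w_{n+1}).$$ Then the problem of minimizing $R(x)$ over $x\in\operatorname{argmin}_{x'\in X}D(Ax';\bar y)$ has a unique solution $x^\dagger$, and the following are equivalent: (i) $\partial R(x^\dagger)\cap\operatorname{Im}A^*\neq\emptyset$; (ii) the dual problem $(D)$ of minimizing $u\mapsto R^*(-A^*u)+\langle\bar y,u\rangle$ over $Y$ has a solution; (iii) the sequence $(u_n)$ is bounded. If one of these holds, then: 1. $(u_n)$ converges weakly to a solution of $(D)$. 2. $(x_n)$ converges strongly to $x^\dagger$, with $\|x_n-x^\dagger\|=o(n^{-1/2})$. 3. For every solution $u^\dagger$ of $(D)$ and every $N\in\mathbb N$ such that $\|u^\dagger\|\lambda_N$ lies in the interior of $\operatorname{dom}\bar m^*=\{t\in\mathbb R:\bar m^*(t)<+\infty\}$, the numbers $\bar m^*(\|u^\dagger\|\lambda_n)$, $n\ge N$, are nonnegative and finite, the series below converges, and $$\|x_n-x^\dagger\|\le\frac{C}{\sqrt{n-N}}\quad\text{for all }n>N,\qquad C^2=\frac{1}{\tau\sigma_R}\|u_N-u^\dagger\|^2+\sum_{n=N}^{+\infty}\frac{2}{\sigma_R\lambda_n}\,\bar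 m^*(\|u^\dagger\|\lambda_n),\quad C\ge 0.$$ -/

import Mathlib

namespace DualDescent

noncomputable section

section ConvexAnalysis

variable {H : Type*} [NormedAddCommGroup H] [InnerProductSpace ℝ H]

/-- `f ∈ Γ₀(H)`: proper, convex and lower semicontinuous functions `H → (-∞, +∞]`. -/
structure GammaZero (f : H → EReal) : Prop where
  ne_bot : ∀ x, f x ≠ ⊥
  proper : ∃ x, f x ≠ ⊤
  convex : ∀ x y : H, ∀ a b : ℝ, 0 < a → 0 < b → a + b = 1 →
    f (a • x + b • y) ≤ (a : EReal) * f x + (b : EReal) * f y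
  lsc : LowerSemicontinuous f

/-- `f ∈ Γ₀(H)` is `σ`-strongly convex if `f - (σ/2)‖·‖² ∈ Γ₀(H)`. -/
def StronglyConvex (σ : ℝ) (f : H → EReal) : Prop :=
  GammaZero f ∧ GammaZero (fun x => f x - ((σ / 2 * ‖x‖ ^ 2 : ℝ) : EReal))

/-- Fenchel conjugate. -/
def conj (f : H → EReal) (v : H) : EReal :=
  ⨆ x : H, ((inner ℝ x v : ℝ) : EReal) - f x

/-- Convex subdifferential. -/
def subdifferential (f : H → EReal) (x : H) : Set H :=
  {v | ∀ x' : H, f x + ((inner ℝ v (x' - x) : ℝ) : EReal) ≤ f x'}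

/-- Infimal convolution. -/
def infConv (f g : H → EReal) (x : H) : EReal :=
  ⨅ x' : H, f x' + g (x - x')

/-- Gradient of the Fenchel conjugate, regarded as a real-valued function
(it is finite everywhere when `f` is strongly convex). -/
def gradConj [CompleteSpace H] (f : H → EReal) (v : H) : H :=
  gradient (fun z => (conj f z).toReal) v

/-- The set of minimizers of `x' ↦ f x' + ‖x' - x‖² / 2`. -/
def proxSet (f : H → EReal) (x : H) : Set H :=
  {q | ∀ x' : H, f q + ((1 / 2 * ‖q - x‖ ^ 2 : ℝ) : EReal)
    ≤ f x' + ((1 / 2 * ‖x' - x‖ ^ 2 : ℝ) : EReal)}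

/-- Proximity operator: the minimizer of `x' ↦ f x' + ‖x' - x‖² / 2`
(which exists and is unique when `f ∈ Γ₀(H)`). -/
def prox (f : H → EReal) (x : H) : H :=
  Classical.epsilon fun q => q ∈ proxSet f x

/-- `lim_{‖x‖ → ∞} f x = +∞`. -/
def Coercive (f : H → EReal) : Prop :=
  Filter.Tendsto f (Bornology.cobounded H) (nhds ⊤)

/-- `f` has a unique minimizer and `m` is a conditioning modulus for `f`. -/
def IsConditioningModulus (f : H → EReal) (m : ℝ → EReal) : Prop :=
  GammaZero m ∧ (∀ t, 0 ≤ m t) ∧ (∀ t, m (-t) = m t) ∧ (∀ t, m t = 0 → t = 0) ∧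
  ∃ x₀ : H, (∀ x, (∀ x', f x ≤ f x') ↔ x = x₀) ∧ ∀ x, m ‖x - x₀‖ ≤ f x - f x₀

/-- `f` is `p`-well conditioned with conditioning modulus `m`. -/
def IsPWellConditioned (p : ℝ) (f : H → EReal) (m : ℝ → EReal) : Prop :=
  IsConditioningModulus f m ∧
  ∃ ε γ : ℝ, 0 < ε ∧ 0 < γ ∧
    ∀ t ∈ Set.Ioo (-ε) ε, ((γ / p * |t| ^ p : ℝ) : EReal) ≤ m t

end ConvexAnalysis

section Problem

variable {X Y : Type*} [NormedAddCommGroup X] [InnerProductSpace ℝ X]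
  [NormedAddCommGroup Y] [InnerProductSpace ℝ Y]

/-- Assumption on the regularizer `R`. -/
structure AssumptionAR (R : X → EReal) (σR : ℝ) (xbar : X) : Prop where
  σR_pos : 0 < σR
  strongly_convex : StronglyConvex σR R
  mem_dom : R xbar < ⊤

/-- The strongly convex part `ψ_y = J_y + (σ_ψ/2)‖·‖²` of the data-fit function. -/
def psi (J : Y → Y → EReal) (σψ : ℝ) (y u : Y) : EReal :=
  J y u + ((σψ / 2 * ‖u‖ ^ 2 : ℝ) : EReal)

/-- Assumption on the data-fit function `D u y = D(u; y)`, with the decomposition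
`D(·; y) = ψ_y # φ_y`, at the exact datum `ybar`. -/
structure AssumptionAD (D : Y → Y → EReal) (J φ : Y → Y → EReal) (σψ : ℝ)
    (ybar : Y) (p : ℝ) (m : ℝ → EReal) : Prop where
  nonneg : ∀ u y, 0 ≤ D u y
  eq_zero_iff : ∀ u y, D u y = 0 ↔ u = y
  σψ_pos : 0 < σψ
  φ_mem : ∀ y, GammaZero (φ y)
  J_mem : ∀ y, GammaZero (J y)
  decomp : ∀ y u, D u y = infConv (psi J σψ y) (φ y) u
  coercive : Coercive fun u => D u ybar
  one_le_p : 1 ≤ p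
  conditioned : IsPWellConditioned p (fun u => D u ybar) m

/-- `x` solves the problem of minimizing `R` over `argmin_{x'} D(A x'; ybar)`. -/
def IsPrimalSolution (R : X → EReal) (D : Y → Y → EReal) (A : X →L[ℝ] Y) (ybar : Y)
    (x : X) : Prop :=
  (∀ x', D (A x) ybar ≤ D (A x') ybar) ∧
  ∀ z, (∀ x', D (A z) ybar ≤ D (A x') ybar) → R x ≤ R z

variable [CompleteSpace X] [CompleteSpace Y]

/-- The dual objective `u ↦ R^*(-A^* u) + ⟨ybar, u⟩`. -/
def dualObjective (R : X → EReal) (A : X →L[ℝ] Y) (ybar : Y) (u : Y) : EReal :=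
  conj R (-(ContinuousLinearMap.adjoint A u)) + ((inner ℝ ybar u : ℝ) : EReal)

/-- `u` minimizes the dual objective. -/
def IsDualSolution (R : X → EReal) (A : X →L[ℝ] Y) (ybar : Y) (u : Y) : Prop :=
  ∀ v, dualObjective R A ybar u ≤ dualObjective R A ybar v

/-- `∂R(x) ∩ Im A^* ≠ ∅`. -/
def SourceCondition (R : X → EReal) (A : X →L[ℝ] Y) (x : X) : Prop :=
  (subdifferential R x ∩ Set.range (ContinuousLinearMap.adjoint A)).Nonempty

/-- `(x_n, w_n, u_n)` is generated by the diagonal dual descent method with datum `y`,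
parameters `lam` and stepsize `τ`. The value of `w 0` plays no role. -/
structure IsDiagonalDualDescent (R : X → EReal) (σR : ℝ) (A : X →L[ℝ] Y)
    (J φ : Y → Y → EReal) (σψ : ℝ) (y : Y) (lam : ℕ → ℝ) (τ : ℝ)
    (x : ℕ → X) (w u : ℕ → Y) : Prop where
  lam_pos : ∀ n, 0 < lam n
  lam_antitone : Antitone lam
  lam_tendsto : Filter.Tendsto lam Filter.atTop (nhds 0)
  τ_pos : 0 < τ
  τ_le : τ ≤ 1 / (‖A‖ ^ 2 / σR + lam 0 / σψ)
  x_eq : ∀ n, x n = gradConj R (-(ContinuousLinearMap.adjoint A (u n)))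
  w_eq : ∀ n, w (n + 1) = u n + τ • A (x n) - τ • gradConj (psi J σψ y) (lam n • u n)
  u_eq : ∀ n, u (n + 1) =
    w (n + 1) - τ • prox (fun v => (((τ * lam n)⁻¹ : ℝ) : EReal) * φ y v) (τ⁻¹ • w (n + 1))

end Problem

end

end DualDescent

/-! Write d(u) = R^*(-A^*u) + ⟨ybar, u⟩ for the dual objective and d_n(u) = R^*(-A^*u) + λ_n⁻¹
D_ybar^*(λ_n u) for its approximations. As D_ybar^* = ψ^* + φ^*, with ψ^* smooth because ψ is
strongly convex, the method is one forward-backward step on each d_n: the stepsize condition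
dominates the Lipschitz constant ‖A‖²/σ_R + λ_n/σ_ψ of the smooth part, and the proximal step on φ
is, by Moreau's decomposition, an implicit step on φ^*.

Three facts compare d_n with d. Since D_ybar(ybar) = 0, d ≤ d_n. Since D_ybar ≥ 0 and λ_n is
nonincreasing, d_{n+1} ≤ d_n. Since D_ybar dominates the modulus, d_n(z) - d(z) ≤ λ_n⁻¹ m^*(‖z‖λ_n)
=: e_n(z), and Young's inequality makes this error summable exactly under the ℓ^{1/(p-1)} condition
(`eventually_finite_and_summable_conj`). With a_n = d_n(u_{n+1}), which is nonincreasing, the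
three-point inequality becomes (`exists_dual_values`) ‖u_{n+1} - z‖² + 2τ(a_n - d(z)) ≤ ‖u_n - z‖² +
2τ e_n(z) whenever e_n(z) is finite.

For arbitrary z this gives limsup a_n ≤ inf d, so every weak cluster point of (u_n) minimizes d;
hence bounded iterates yield a dual solution. For a dual solution z the distances ‖u_n - z‖
converge, so Opial's lemma gives weak convergence, and the gaps a_n - d(z) are summable and
nonincreasing, hence o(1/n), with an explicit O(1/n) bound. Strong convexity of R transfers this to
the primal: σ_R/2 ‖x_n - x†‖² ≤ d(u_n) + R(x†), and min d = -R(x†) once a dual solution exists. -/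

namespace DualDescent

open Filter Topology

/-! ### Convex minimization over epigraphs. -/

section Epigraph

variable {H : Type*} [NormedAddCommGroup H] [InnerProductSpace ℝ H]

/-- The real epigraph of an extended-real-valued function. -/
def realEpigraph (f : H → EReal) : Set (H × ℝ) := {z | f z.1 ≤ (z.2 : EReal)}

lemma GammaZero.isClosed_realEpigraph {f : H → EReal} (hf : GammaZero f) :
    IsClosed (realEpigraph f) :=
  hf.lsc.isClosed_epigraph.preimage
    (continuous_fst.prodMk (continuous_coe_real_ereal.comp continuous_snd))

lemma GammaZero.convex_realEpigraph {f : H → EReal} (hf : GammaZero f) :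
    Convex ℝ (realEpigraph f) := by
  rw [convex_iff_forall_pos]
  rintro ⟨x, s⟩ hx ⟨y, t⟩ hy a b ha hb hab
  simp only [realEpigraph, Set.mem_ofPred_eq] at hx hy ⊢
  refine (hf.convex x y a b ha hb hab).trans ?_
  have h1 : (a : EReal) * f x ≤ (a : EReal) * s :=
    mul_le_mul_of_nonneg_left hx (by exact_mod_cast ha.le)
  have h2 : (b : EReal) * f y ≤ (b : EReal) * t :=
    mul_le_mul_of_nonneg_left hy (by exact_mod_cast hb.le)
  refine (add_le_add h1 h2).trans (le_of_eq ?_)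
  simp

lemma GammaZero.exists_coe_eq {f : H → EReal} (hf : GammaZero f) {x : H} (hx : f x ≠ ⊤) :
    ∃ r : ℝ, f x = r :=
  ⟨(f x).toReal, (EReal.coe_toReal hx (hf.ne_bot x)).symm⟩

/-- Lower semicontinuity bounds f below on a ball around a point of its domain; convexity spreads
this to a linear bound, so no separation theorem is needed. -/
lemma GammaZero.exists_linear_lower_bound {f : H → EReal} (hf : GammaZero f) :
    ∃ c C : ℝ, ∀ z ∈ realEpigraph f, c - C * ‖z.1‖ ≤ z.2 := by
  obtain ⟨x₀, hx₀⟩ := hf.proper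
  obtain ⟨r, hr⟩ := hf.exists_coe_eq hx₀
  have hlt : ((r - 1 : ℝ) : EReal) < f x₀ := by
    rw [hr]; exact_mod_cast sub_one_lt r
  obtain ⟨δ, hδ, hball⟩ := Metric.eventually_nhds_iff.1 (hf.lsc x₀ _ hlt)
  refine ⟨r - 1 - 2 / δ * ‖x₀‖, 2 / δ, ?_⟩
  rintro ⟨x, s⟩ hx
  have hloc : ∀ z : H × ℝ, z ∈ realEpigraph f → ‖z.1 - x₀‖ < δ → r - 1 < z.2 := by
    intro z hz hzδ
    have h1 := hball (y := z.1) (by rwa [dist_eq_norm])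
    exact_mod_cast h1.trans_le hz
  have hnorm : ‖x - x₀‖ ≤ ‖x‖ + ‖x₀‖ := norm_sub_le _ _
  have key : r - 1 - 2 / δ * ‖x - x₀‖ ≤ s := by
    have hd : 0 < 2 / δ := by positivity
    rcases lt_or_ge ‖x - x₀‖ δ with h | h
    · have h1 := hloc (x, s) hx h
      have h2 : 0 ≤ 2 / δ * ‖x - x₀‖ := by positivity
      simp only at h1
      linarith
    · have hpos : 0 < ‖x - x₀‖ := hδ.trans_le h
      -- This t pulls x back to distance δ/2 from x₀, inside the ball where the local bound holds.
      set t : ℝ := δ / (2 * ‖x - x₀‖) with ht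
      have ht0 : 0 < t := by positivity
      have ht1 : t ≤ 1 := by
        rw [ht, div_le_one (by positivity)]; linarith
      have hmem := hf.convex_realEpigraph (x := (x₀, r)) (y := (x, s)) hr.le hx
        (sub_nonneg.2 ht1) ht0.le (by ring)
      have h1 := hloc _ hmem (by
        have : ((1 - t) • (x₀, r) + t • (x, s)).1 - x₀ = t • (x - x₀) := by
          simp only [Prod.fst_add, Prod.smul_fst]; module
        rw [this, norm_smul, Real.norm_of_nonneg ht0.le, ht]
        field_simp
        linarith)
      simp only [Prod.snd_add, Prod.smul_snd, smul_eq_mul] at h1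
      have h2 : -1 < t * (s - r) := by linarith
      have h3 : t * (2 / δ * ‖x - x₀‖) = 1 := by rw [ht]; field_simp
      have h4 : 0 < t * ((s - r) + 2 / δ * ‖x - x₀‖) := by rw [mul_add, h3]; linarith
      have := (pos_iff_pos_of_mul_pos h4).1 ht0
      linarith
  have : 2 / δ * ‖x - x₀‖ ≤ 2 / δ * (‖x‖ + ‖x₀‖) := by gcongr
  simp only
  linarith

/-- Minty's surjectivity for closed convex epigraph-like sets: the tilted quadratic perturbation of
the height function attains its minimum, and the optimality condition holds there. -/
lemma exists_minimizer_quadratic_perturbation [CompleteSpace H] {E : Set (H × ℝ)}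
    (hclosed : IsClosed E) (hconv : Convex ℝ E) (hne : E.Nonempty) {c C : ℝ}
    (hlow : ∀ z ∈ E, c - C * ‖z.1‖ ≤ z.2) {σ : ℝ} (hσ : 0 < σ) (v : H) :
    ∃ q ∈ E, ∀ z ∈ E, q.2 + inner ℝ (v - σ • q.1) (z.1 - q.1) ≤ z.2 := by
  set F : H × ℝ → ℝ := fun z => z.2 + σ / 2 * ‖z.1‖ ^ 2 - inner ℝ v z.1 with hF
  have hbdd : BddBelow (F '' E) := by
    refine ⟨c - (C + ‖v‖) ^ 2 / (2 * σ), ?_⟩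
    rintro _ ⟨z, hz, rfl⟩
    have h1 := hlow z hz
    have h2 := real_inner_le_norm v z.1
    have h3 : 0 ≤ (σ * ‖z.1‖ - (C + ‖v‖)) ^ 2 / (2 * σ) := by positivity
    have h4 : (σ * ‖z.1‖ - (C + ‖v‖)) ^ 2 / (2 * σ) =
        σ / 2 * ‖z.1‖ ^ 2 - (C + ‖v‖) * ‖z.1‖ + (C + ‖v‖) ^ 2 / (2 * σ) := by
      field_simp; ring
    simp only [hF]
    linarith
  set I := sInf (F '' E) with hI
  have hIle : ∀ z ∈ E, I ≤ F z := fun z hz => csInf_le hbdd ⟨z, hz, rfl⟩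
  have hseq : ∀ n : ℕ, ∃ z ∈ E, F z < I + 1 / ((n : ℝ) + 1) := by
    intro n
    obtain ⟨_, ⟨z, hz, rfl⟩, h⟩ := exists_lt_of_csInf_lt (hne.image F)
      (lt_add_of_pos_right I (Nat.one_div_pos_of_nat (α := ℝ) (n := n)))
    exact ⟨z, hz, h⟩
  choose z hzE hzlt using hseq
  -- The midpoint stays in E, and the parallelogram identity turns near-minimality of a and b into
  -- closeness of their base points.
  have hmid : ∀ a ∈ E, ∀ b ∈ E, σ / 8 * ‖a.1 - b.1‖ ^ 2 ≤ (F a + F b) / 2 - I := by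
    intro a ha b hb
    have h1 := hIle _ (hconv ha hb (a := 1 / 2) (b := 1 / 2) (by norm_num) (by norm_num)
      (by norm_num))
    have e1 : ‖((1 / 2 : ℝ) • a + (1 / 2 : ℝ) • b).1‖ ^ 2 =
        1 / 4 * (‖a.1‖ ^ 2 + 2 * inner ℝ a.1 b.1 + ‖b.1‖ ^ 2) := by
      rw [Prod.fst_add, Prod.smul_fst, Prod.smul_fst, ← smul_add, norm_smul, mul_pow,
        norm_add_sq_real]
      norm_num
    have e2 := norm_sub_sq_real a.1 b.1
    simp only [hF, e1] at h1 ⊢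
    simp only [Prod.fst_add, Prod.snd_add, Prod.smul_fst, Prod.smul_snd, smul_eq_mul,
      inner_add_right, real_inner_smul_right] at h1
    rw [e2]
    linarith
  have hcau : CauchySeq fun n => (z n).1 := by
    refine cauchySeq_of_le_tendsto_0 (fun N : ℕ => √(8 / σ * (1 / ((N : ℝ) + 1)))) ?_ ?_
    · intro n k N hn hk
      rw [dist_eq_norm]
      apply Real.le_sqrt_of_sq_le
      have h1 := hmid _ (hzE n) _ (hzE k)
      have h2 : F (z n) < I + 1 / ((N : ℝ) + 1) :=
        (hzlt n).trans_le (by gcongr)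
      have h3 : F (z k) < I + 1 / ((N : ℝ) + 1) :=
        (hzlt k).trans_le (by gcongr)
      have h4 : σ / 8 * ‖(z n).1 - (z k).1‖ ^ 2 ≤ 1 / ((N : ℝ) + 1) := by linarith
      calc ‖(z n).1 - (z k).1‖ ^ 2 = 8 / σ * (σ / 8 * ‖(z n).1 - (z k).1‖ ^ 2) := by
            field_simp
        _ ≤ _ := by gcongr
    · have := ((tendsto_one_div_add_atTop_nhds_zero_nat (𝕜 := ℝ)).const_mul (8 / σ)).sqrt
      simpa using this
  obtain ⟨q, hq⟩ := cauchySeq_tendsto_of_complete hcau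
  have hFlim : Tendsto (fun n => F (z n)) atTop (𝓝 I) := by
    refine tendsto_of_tendsto_of_tendsto_of_le_of_le tendsto_const_nhds ?_
      (fun n => hIle _ (hzE n)) (fun n => (hzlt n).le)
    simpa using (tendsto_one_div_add_atTop_nhds_zero_nat (𝕜 := ℝ)).const_add I
  set r := I - σ / 2 * ‖q‖ ^ 2 + inner ℝ v q with hr
  have hslim : Tendsto (fun n => (z n).2) atTop (𝓝 r) := by
    have h1 : Tendsto (fun n => F (z n) - σ / 2 * ‖(z n).1‖ ^ 2 + inner ℝ v (z n).1) atTop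
        (𝓝 r) :=
      (hFlim.sub ((hq.norm.pow 2).const_mul (σ / 2))).add (tendsto_const_nhds.inner hq)
    refine h1.congr fun n => ?_
    simp only [hF]; ring
  have hqE : (q, r) ∈ E :=
    hclosed.mem_of_tendsto (hq.prodMk_nhds hslim) (Eventually.of_forall hzE)
  refine ⟨(q, r), hqE, ?_⟩
  rintro ⟨x, s⟩ hx
  -- First-order optimality: compare with the segment towards (x, s), divide by t, then let t tend
  -- to 0.
  have hvar : ∀ t : ℝ, 0 < t → t ≤ 1 →
      r + inner ℝ (v - σ • q) (x - q) ≤ s + t * (σ / 2 * ‖x - q‖ ^ 2) := by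
    intro t ht0 ht1
    have h1 := hIle _ (hconv hqE hx (sub_nonneg.2 ht1) ht0.le (by ring))
    have e0 : (1 - t) • q + t • x = q + t • (x - q) := by module
    have e1 : ‖(1 - t) • q + t • x‖ ^ 2 =
        ‖q‖ ^ 2 + 2 * (t * inner ℝ q (x - q)) + t ^ 2 * ‖x - q‖ ^ 2 := by
      rw [e0, norm_add_sq_real, real_inner_smul_right, norm_smul, mul_pow,
        Real.norm_of_nonneg ht0.le]
    simp only [hF, Prod.fst_add, Prod.snd_add, Prod.smul_fst, Prod.smul_snd, smul_eq_mul,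
      e1] at h1
    rw [e0, inner_add_right, real_inner_smul_right] at h1
    rw [inner_sub_left, real_inner_smul_left]
    have h2 : 0 ≤ t * (s + t * (σ / 2 * ‖x - q‖ ^ 2) -
        (r + (inner ℝ v (x - q) - σ * inner ℝ q (x - q)))) := by
      linarith
    have := nonneg_of_mul_nonneg_right h2 ht0
    linarith
  have hlim : Tendsto (fun t : ℝ => s + t * (σ / 2 * ‖x - q‖ ^ 2)) (𝓝[>] 0)
      (𝓝 (s + 0 * (σ / 2 * ‖x - q‖ ^ 2))) :=
    ((continuous_const.add (continuous_id.mul continuous_const)).tendsto 0).mono_left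
      nhdsWithin_le_nhds
  rw [zero_mul, add_zero] at hlim
  refine ge_of_tendsto hlim ?_
  filter_upwards [Ioc_mem_nhdsGT (zero_lt_one' ℝ)] with t ht
  exact hvar t ht.1 ht.2

end Epigraph

/-! ### Supporting quadratics, smoothness of conjugates, proximity operators. -/

section Support

variable {H : Type*} [NormedAddCommGroup H] [InnerProductSpace ℝ H]

/-- `f q = r` is finite and `x ↦ r + ⟪v, x - q⟫ + (σ/2)‖x - q‖²` is a minorant of `f`. -/
structure SupportsAt (f : H → EReal) (σ : ℝ) (v q : H) (r : ℝ) : Prop where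
  eq : f q = r
  le : ∀ (x : H) (s : ℝ), f x ≤ s → r + inner ℝ v (x - q) + σ / 2 * ‖x - q‖ ^ 2 ≤ s

/-- Testing f only through its real upper bounds turns every later estimate on conjugates into real
arithmetic, free of ∞ - ∞. -/
lemma conj_le_coe_iff {f : H → EReal} {v : H} {c : ℝ} :
    conj f v ≤ (c : EReal) ↔ ∀ (x : H) (s : ℝ), f x ≤ s → inner ℝ x v - s ≤ c := by
  rw [conj, iSup_le_iff]
  refine forall_congr' fun x => ?_
  induction f x with
  | bot =>
    simp only [EReal.coe_sub_bot, top_le_iff, EReal.coe_ne_top, bot_le, forall_const, false_iff,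
      not_forall, not_le]
    exact ⟨inner ℝ x v - c - 1, by linarith⟩
  | top => simp
  | coe t =>
    rw [← EReal.coe_sub, EReal.coe_le_coe_iff]
    exact ⟨fun h s hs => (sub_le_sub_left (EReal.coe_le_coe_iff.1 hs) _).trans h,
      fun h => h t le_rfl⟩

lemma coe_le_conj {f : H → EReal} {x v : H} {r : ℝ} (h : f x ≤ r) :
    ((inner ℝ x v - r : ℝ) : EReal) ≤ conj f v := by
  refine le_trans ?_ (le_iSup (fun x : H => ((inner ℝ x v : ℝ) : EReal) - f x) x)
  rw [EReal.coe_sub]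
  exact EReal.sub_le_sub le_rfl h

lemma GammaZero.conj_ne_bot {f : H → EReal} (hf : GammaZero f) (v : H) : conj f v ≠ ⊥ := by
  obtain ⟨x, hx⟩ := hf.proper
  obtain ⟨r, hr⟩ := hf.exists_coe_eq hx
  exact ne_bot_of_le_ne_bot (EReal.coe_ne_bot _) (coe_le_conj (v := v) hr.le)

lemma GammaZero.exists_conj_eq {f : H → EReal} (hf : GammaZero f) {v : H} (h : conj f v ≠ ⊤) :
    conj f v = ((conj f v).toReal : EReal) :=
  (EReal.coe_toReal h (hf.conj_ne_bot v)).symm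

namespace SupportsAt

variable {f : H → EReal} {σ : ℝ} {v q : H} {r : ℝ}

lemma conj_eq (hσ : 0 ≤ σ) (h : SupportsAt f σ v q r) :
    conj f v = ((inner ℝ q v - r : ℝ) : EReal) := by
  refine le_antisymm (conj_le_coe_iff.2 fun x s hs => ?_) (coe_le_conj h.eq.le)
  have h1 := h.le x s hs
  have h2 : 0 ≤ σ / 2 * ‖x - q‖ ^ 2 := by positivity
  rw [inner_sub_right, real_inner_comm, real_inner_comm q v] at h1
  linarith

lemma toReal_conj_eq (hσ : 0 ≤ σ) (h : SupportsAt f σ v q r) :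
    (conj f v).toReal = inner ℝ q v - r := by
  rw [h.conj_eq hσ, EReal.toReal_coe]

/-- Descent lemma for the conjugate: test the strong subgradient inequality at q' and use that ‖(v'
- v) - σ(q' - q)‖² is nonnegative. -/
lemma conj_le_quadratic (hσ : 0 < σ) (h : SupportsAt f σ v q r) {v' q' : H} {r' : ℝ}
    (h' : SupportsAt f σ v' q' r') :
    inner ℝ q' v' - r' ≤
      inner ℝ q v - r + inner ℝ q (v' - v) + 1 / (2 * σ) * ‖v' - v‖ ^ 2 := by
  have h1 := h.le q' r' h'.eq.le
  have h2 : 0 ≤ 1 / (2 * σ) * ‖(v' - v) - σ • (q' - q)‖ ^ 2 := by positivity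
  have h3 : 1 / (2 * σ) * ‖(v' - v) - σ • (q' - q)‖ ^ 2 =
      1 / (2 * σ) * ‖v' - v‖ ^ 2 - inner ℝ (v' - v) (q' - q) + σ / 2 * ‖q' - q‖ ^ 2 := by
    rw [norm_sub_sq_real, real_inner_smul_right, norm_smul, mul_pow, Real.norm_of_nonneg hσ.le]
    field_simp
  rw [h3] at h2
  simp only [inner_sub_left, inner_sub_right] at h1 h2 ⊢
  rw [real_inner_comm v' q', real_inner_comm v' q, real_inner_comm v q]
  linarith

lemma linear_le_conj (hσ : 0 ≤ σ) (h : SupportsAt f σ v q r) {v' : H} {c : ℝ}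
    (hc : conj f v' ≤ c) :
    (conj f v).toReal + inner ℝ q (v' - v) ≤ c := by
  have := conj_le_coe_iff.1 hc q r h.eq.le
  rw [h.toReal_conj_eq hσ, inner_sub_right]
  linarith

end SupportsAt

lemma hasGradientAt_of_quadratic_bounds [CompleteSpace H] {F : H → ℝ} {v g : H} {c : ℝ}
    (hlow : ∀ z, F v + inner ℝ g (z - v) ≤ F z)
    (hup : ∀ z, F z ≤ F v + inner ℝ g (z - v) + c * ‖z - v‖ ^ 2) :
    HasGradientAt F g v := by
  rw [hasGradientAt_iff_isLittleO]
  have h1 : (fun z => F z - F v - inner ℝ g (z - v)) =O[𝓝 v] fun z => ‖z - v‖ ^ 2 := by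
    refine Asymptotics.IsBigO.of_bound c (Eventually.of_forall fun z => ?_)
    rw [Real.norm_of_nonneg (by linarith [hlow z]), norm_pow, norm_norm]
    linarith [hup z]
  refine h1.trans_isLittleO ?_
  refine (Asymptotics.isLittleO_norm_pow_id one_lt_two).comp_tendsto (k := fun z => z - v) ?_
  have : Continuous fun z : H => z - v := by fun_prop
  simpa using this.tendsto v

/-- Surjectivity of ∂f + σ·Id, from minimizing over the epigraph of f. -/
lemma GammaZero.exists_supportsAt {f : H → EReal} [CompleteSpace H] (hf : GammaZero f) {σ : ℝ}
    (hσ : 0 < σ) (v : H) : ∃ q r, SupportsAt f 0 (v - σ • q) q r := by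
  obtain ⟨c, C, hlow⟩ := hf.exists_linear_lower_bound
  obtain ⟨x₀, hx₀⟩ := hf.proper
  obtain ⟨r₀, hr₀⟩ := hf.exists_coe_eq hx₀
  obtain ⟨⟨q, r⟩, hq, hmin⟩ := exists_minimizer_quadratic_perturbation hf.isClosed_realEpigraph
    hf.convex_realEpigraph ⟨(x₀, r₀), hr₀.le⟩ hlow hσ v
  obtain ⟨r', hr'⟩ := hf.exists_coe_eq (x := q) (ne_top_of_le_ne_top (EReal.coe_ne_top r) hq)
  -- The minimizer found is a point (q, r) of the epigraph; testing against (q, f q) shows that r =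
  -- f q.
  have h1 : r ≤ r' := by simpa using hmin (q, r') hr'.le
  have h2 : f q ≤ r := hq
  rw [hr', EReal.coe_le_coe_iff] at h2
  obtain rfl := le_antisymm h1 h2
  exact ⟨q, r, hr', fun x s hs => by simpa using hmin (x, s) hs⟩

/-- A subgradient v - σq of g at q becomes a strong subgradient v of g + (σ/2)‖·‖², because the
quadratic expands exactly around q. -/
lemma GammaZero.exists_supportsAt_add_sq [CompleteSpace H] {f g : H → EReal} (hg : GammaZero g)
    {σ : ℝ} (hσ : 0 < σ) (hfg : ∀ x, f x = g x + ((σ / 2 * ‖x‖ ^ 2 : ℝ) : EReal)) (v : H) :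
    ∃ q r, SupportsAt f σ v q r := by
  obtain ⟨q, r, h⟩ := hg.exists_supportsAt hσ v
  refine ⟨q, r + σ / 2 * ‖q‖ ^ 2, by rw [hfg, h.eq, ← EReal.coe_add], fun x s hs => ?_⟩
  rw [hfg] at hs
  have hs' : g x ≤ ((s - σ / 2 * ‖x‖ ^ 2 : ℝ) : EReal) := by
    rw [EReal.coe_sub]
    exact (EReal.le_sub_iff_add_le (.inl (EReal.coe_ne_bot _)) (.inl (EReal.coe_ne_top _))).2 hs
  have h1 := h.le x _ hs'
  have h2 : ‖x‖ ^ 2 = ‖q‖ ^ 2 + 2 * inner ℝ q (x - q) + ‖x - q‖ ^ 2 := by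
    rw [← norm_add_sq_real, add_sub_cancel]
  rw [inner_sub_left, real_inner_smul_left] at h1
  rw [h2] at h1
  linarith

lemma StronglyConvex.exists_supportsAt [CompleteSpace H] {f : H → EReal} {σ : ℝ} (hσ : 0 < σ)
    (hf : StronglyConvex σ f) (v : H) : ∃ q r, SupportsAt f σ v q r :=
  hf.2.exists_supportsAt_add_sq hσ (fun _ => EReal.sub_add_cancel.symm) v

/-- Identifies the gradient of f^* at v with the point where v supports f: f^* lies between an
affine function and the same function plus a quadratic. -/
lemma exists_supportsAt_gradConj [CompleteSpace H] {f : H → EReal} {σ : ℝ} (hσ : 0 < σ)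
    (hf : ∀ v, ∃ q r, SupportsAt f σ v q r) (v : H) :
    ∃ r, SupportsAt f σ v (gradConj f v) r := by
  obtain ⟨q, r, h⟩ := hf v
  suffices gradConj f v = q by rw [this]; exact ⟨r, h⟩
  refine (hasGradientAt_of_quadratic_bounds (c := 1 / (2 * σ)) ?_ ?_).gradient
  · intro z
    obtain ⟨q', r', h'⟩ := hf z
    refine h.linear_le_conj hσ.le ?_
    rw [h'.conj_eq hσ.le, EReal.toReal_coe]
  · intro z
    obtain ⟨q', r', h'⟩ := hf z
    rw [h.toReal_conj_eq hσ.le, h'.toReal_conj_eq hσ.le]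
    exact h.conj_le_quadratic hσ h'

lemma coe_toReal_conj {f : H → EReal} {σ : ℝ} (hσ : 0 < σ)
    (hf : ∀ v, ∃ q r, SupportsAt f σ v q r) (v : H) :
    conj f v = ((conj f v).toReal : EReal) := by
  obtain ⟨q, r, h⟩ := hf v
  rw [h.conj_eq hσ.le, EReal.toReal_coe]

lemma toReal_conj_ge_linear [CompleteSpace H] {f : H → EReal} {σ : ℝ} (hσ : 0 < σ)
    (hf : ∀ v, ∃ q r, SupportsAt f σ v q r) (v z : H) :
    (conj f v).toReal + inner ℝ (gradConj f v) (z - v) ≤ (conj f z).toReal := by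
  obtain ⟨r, h⟩ := exists_supportsAt_gradConj hσ hf v
  exact h.linear_le_conj hσ.le (coe_toReal_conj hσ hf z).le

lemma toReal_conj_le_quadratic [CompleteSpace H] {f : H → EReal} {σ : ℝ} (hσ : 0 < σ)
    (hf : ∀ v, ∃ q r, SupportsAt f σ v q r) (v z : H) :
    (conj f z).toReal ≤
      (conj f v).toReal + inner ℝ (gradConj f v) (z - v) + 1 / (2 * σ) * ‖z - v‖ ^ 2 := by
  obtain ⟨r, h⟩ := exists_supportsAt_gradConj hσ hf v
  obtain ⟨q', r', h'⟩ := hf z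
  rw [h.toReal_conj_eq hσ.le, h'.toReal_conj_eq hσ.le]
  exact h.conj_le_quadratic hσ h'

/-- The optimality condition characterizing the proximity operator. -/
lemma GammaZero.exists_supportsAt_prox [CompleteSpace H] {f : H → EReal} (hf : GammaZero f)
    {c : ℝ} (hc : 0 < c) (z : H) :
    ∃ r, SupportsAt f 0 (c⁻¹ • (z - prox (fun v => (c : EReal) * f v) z))
      (prox (fun v => (c : EReal) * f v) z) r := by
  obtain ⟨q, r, h⟩ := hf.exists_supportsAt (inv_pos.2 hc) (c⁻¹ • z)
  rw [← smul_sub] at h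
  have hgrow : ∀ (x : H) (s : ℝ), f x ≤ s →
      c * r + 1 / 2 * ‖q - z‖ ^ 2 + 1 / 2 * ‖x - q‖ ^ 2 ≤ c * s + 1 / 2 * ‖x - z‖ ^ 2 := by
    intro x s hs
    have h1 := mul_le_mul_of_nonneg_left (h.le x s hs) hc.le
    rw [real_inner_smul_left, mul_add, mul_add, mul_inv_cancel_left₀ hc.ne'] at h1
    have h2 : ‖x - z‖ ^ 2 = ‖x - q‖ ^ 2 - 2 * inner ℝ (x - q) (z - q) + ‖q - z‖ ^ 2 := by
      rw [norm_sub_rev q z, ← norm_sub_sq_real, sub_sub_sub_cancel_right]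
    rw [h2, real_inner_comm]
    linarith
  have hmem : q ∈ proxSet (fun v => (c : EReal) * f v) z := by
    intro x
    by_cases hx : f x = ⊤
    · simp only [hx, EReal.coe_mul_top_of_pos hc, EReal.top_add_coe, le_top]
    · obtain ⟨s, hs⟩ := hf.exists_coe_eq hx
      simp only [hs, h.eq]
      have h1 := hgrow x s hs.le
      have h2 : 0 ≤ 1 / 2 * ‖x - q‖ ^ 2 := by positivity
      exact_mod_cast (by linarith : c * r + 1 / 2 * ‖q - z‖ ^ 2 ≤ c * s + 1 / 2 * ‖x - z‖ ^ 2)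
  have hprox : prox (fun v => (c : EReal) * f v) z ∈ proxSet (fun v => (c : EReal) * f v) z :=
    -- The chosen point is known only to be a minimizer; the quadratic growth `hgrow` forces it to
    -- equal q.
    Classical.epsilon_spec (p := fun q => q ∈ proxSet (fun v => (c : EReal) * f v) z) ⟨q, hmem⟩
  suffices prox (fun v => (c : EReal) * f v) z = q by rw [this]; exact ⟨r, h⟩
  set q' := prox (fun v => (c : EReal) * f v) z
  have h1 := hprox q
  simp only [h.eq] at h1
  have hq' : f q' ≠ ⊤ := by
    intro ht
    rw [ht, EReal.coe_mul_top_of_pos hc, EReal.top_add_coe, top_le_iff] at h1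
    exact EReal.coe_ne_top (c * r + 1 / 2 * ‖q - z‖ ^ 2) (by exact_mod_cast h1)
  obtain ⟨s, hs⟩ := hf.exists_coe_eq hq'
  rw [hs] at h1
  have h2 : c * s + 1 / 2 * ‖q' - z‖ ^ 2 ≤ c * r + 1 / 2 * ‖q - z‖ ^ 2 := by exact_mod_cast h1
  have h3 := hgrow q' s hs.le
  have h4 : ‖q' - q‖ ^ 2 ≤ 0 := by linarith
  have h5 : ‖q' - q‖ = 0 := pow_eq_zero_iff two_ne_zero |>.1 (le_antisymm h4 (sq_nonneg _))
  exact sub_eq_zero.1 (norm_eq_zero.1 h5)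

lemma supportsAt_zero_iff_mem_subdifferential {f : H → EReal} {x v : H} {r : ℝ} (hr : f x = r) :
    SupportsAt f 0 v x r ↔ v ∈ subdifferential f x := by
  constructor
  · intro h z
    refine EReal.le_of_forall_lt_iff_le.1 fun s hs => ?_
    rw [hr, ← EReal.coe_add, EReal.coe_le_coe_iff]
    simpa using h.le z s hs.le
  · intro h
    refine ⟨hr, fun z s hs => ?_⟩
    have h1 := (h z).trans hs
    rw [hr, ← EReal.coe_add, EReal.coe_le_coe_iff] at h1
    simpa using h1

end Support

/-! ### The conjugate of the conditioning modulus near zero. -/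

section Modulus

variable {m : ℝ → EReal}

lemma conj_nonneg_of_zero (h0 : m 0 = 0) (s : ℝ) : 0 ≤ conj m s := by
  have := coe_le_conj (f := m) (x := 0) (v := s) (r := 0) (by simp [h0])
  simpa using this

lemma conj_le_conj_of_le (hnn : ∀ t, 0 ≤ m t) (h0 : m 0 = 0) {s s' : ℝ} (hs : 0 ≤ s)
    (hss : s ≤ s') : conj m s ≤ conj m s' := by
  refine EReal.le_of_forall_lt_iff_le.1 fun c hc => conj_le_coe_iff.2 fun t a ha => ?_
  have hc0 : (0 : ℝ) ≤ c := by exact_mod_cast (conj_nonneg_of_zero h0 s').trans hc.le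
  have ha0 : (0 : ℝ) ≤ a := by exact_mod_cast (hnn t).trans ha
  have h1 := conj_le_coe_iff.1 hc.le t a ha
  simp only [RCLike.inner_apply, conj_trivial] at h1 ⊢
  rcases le_total 0 t with ht | ht
  · nlinarith
  · nlinarith

/-- Since m(0) = 0, convexity makes m(t)/|t| nondecreasing along each ray. -/
lemma linear_growth_of_local_growth (hm : GammaZero m) (h0 : m 0 = 0) {t₀ g : ℝ} (ht₀ : 0 < t₀)
    (hg : ∀ t, |t| = t₀ → ((g : ℝ) : EReal) ≤ m t) {t s : ℝ} (ht : t₀ ≤ |t|) (hs : m t ≤ s) :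
    g / t₀ * |t| ≤ s := by
  have htp : 0 < |t| := ht₀.trans_le ht
  have hθ0 : 0 ≤ t₀ / |t| := by positivity
  have hθ1 : t₀ / |t| ≤ 1 := (div_le_one htp).2 ht
  have hmem := hm.convex_realEpigraph (x := ((0 : ℝ), (0 : ℝ))) (y := (t, s))
    (by simp [realEpigraph, h0]) hs (sub_nonneg.2 hθ1) hθ0 (by ring)
  have h1 := hg (t₀ / |t| * t) (by rw [abs_mul, abs_of_nonneg hθ0]; field_simp)
  have h2 : m (t₀ / |t| * t) ≤ ((t₀ / |t| * s : ℝ) : EReal) := by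
    simpa [realEpigraph] using hmem
  have h3 : g ≤ t₀ / |t| * s := by exact_mod_cast h1.trans h2
  calc g / t₀ * |t| ≤ (t₀ / |t| * s) / t₀ * |t| := by gcongr
    _ = s := by field_simp

lemma exists_conj_bound_of_local_growth (hm : GammaZero m) (hnn : ∀ t, 0 ≤ m t) (h0 : m 0 = 0)
    {p ε γ : ℝ} (hε : 0 < ε) (hγ : 0 < γ) (hp : 1 ≤ p)
    (hloc : ∀ t ∈ Set.Ioo (-ε) ε, ((γ / p * |t| ^ p : ℝ) : EReal) ≤ m t) {h : ℝ → ℝ}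
    (hh : ∀ s, 0 ≤ s → 0 ≤ h s)
    (hconj : ∀ s t, 0 ≤ s → s ≤ γ / p → 0 ≤ t → s * t - γ / p * t ^ p ≤ h s) :
    ∃ κ > 0, ∀ s, 0 ≤ s → s ≤ κ → conj m s ≤ ((h s : ℝ) : EReal) := by
  have hp0 : 0 < p := by linarith
  have hgp : 0 < γ / p := by positivity
  set t₀ := ε / 2 with ht₀
  have ht₀p : 0 < t₀ := by positivity
  set g := γ / p * t₀ ^ p with hg
  have hgpos : 0 < g := by positivity
  -- Below g/t₀, the slope of the linear growth, points with |t| ≥ t₀ contribute at most 0 to the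
  -- supremum; γ/p is the range where `hconj` controls the others.
  refine ⟨min (γ / p) (g / t₀), by positivity, fun s hs hsκ => conj_le_coe_iff.2 fun t a ha => ?_⟩
  have h1 : s ≤ γ / p := hsκ.trans (min_le_left _ _)
  have h2 : s ≤ g / t₀ := hsκ.trans (min_le_right _ _)
  have ha0 : (0 : ℝ) ≤ a := by exact_mod_cast (hnn t).trans ha
  have hin : inner ℝ t s ≤ s * |t| := by
    simp only [RCLike.inner_apply, conj_trivial]
    exact mul_le_mul_of_nonneg_left (le_abs_self t) hs
  rcases lt_or_ge |t| t₀ with ht | ht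
  · have h3 : ((γ / p * |t| ^ p : ℝ) : EReal) ≤ a :=
      (hloc t (abs_lt.1 (by linarith))).trans ha
    have h4 : γ / p * |t| ^ p ≤ a := by exact_mod_cast h3
    have := hconj s |t| hs h1 (abs_nonneg t)
    linarith
  · have h3 := linear_growth_of_local_growth hm h0 ht₀p (g := g) (fun t' ht' => by
      have := hloc t' (abs_lt.1 (by linarith))
      rwa [ht'] at this) ht ha
    have h4 : s * |t| ≤ g / t₀ * |t| := by gcongr
    linarith [hh s hs]

/-- Young's inequality applied to t γ^{1/p} and s γ^{-1/p}, whose product is st. -/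
lemma young_rpow {p γ : ℝ} (hp : 1 < p) (hγ : 0 < γ) {s t : ℝ} (hs : 0 ≤ s) (ht : 0 ≤ t) :
    s * t - γ / p * t ^ p ≤
      (γ ^ (-1 / p)) ^ (p / (p - 1)) / (p / (p - 1)) * s ^ (p / (p - 1)) := by
  have hp0 : 0 < p := by linarith
  have hpq : p.HolderConjugate (p / (p - 1)) := Real.HolderConjugate.conjExponent hp
  have h := Real.young_inequality_of_nonneg (a := t * γ ^ (1 / p)) (b := s * γ ^ (-1 / p))
    (by positivity) (by positivity) hpq
  have e1 : t * γ ^ (1 / p) * (s * γ ^ (-1 / p)) = s * t := by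
    have : γ ^ (1 / p) * γ ^ (-1 / p) = 1 := by
      rw [← Real.rpow_add hγ, neg_div, add_neg_cancel, Real.rpow_zero]
    linear_combination (t * s) * this
  have e2 : (t * γ ^ (1 / p)) ^ p = t ^ p * γ := by
    rw [Real.mul_rpow ht (by positivity), ← Real.rpow_mul hγ.le, one_div_mul_cancel hp0.ne',
      Real.rpow_one]
  have e3 : (s * γ ^ (-1 / p)) ^ (p / (p - 1)) =
      s ^ (p / (p - 1)) * (γ ^ (-1 / p)) ^ (p / (p - 1)) :=
    Real.mul_rpow hs (by positivity)
  rw [e1, e2, e3] at h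
  have e4 : t ^ p * γ / p = γ / p * t ^ p := by ring
  rw [e4, mul_comm (s ^ _), mul_div_right_comm] at h
  linarith

/-- The perturbation terms `λₙ⁻¹ m^*(b λₙ)` are eventually finite and summable when
`λ ∈ ℓ^{1/(p-1)}`. -/
lemma eventually_finite_and_summable_conj (hm : GammaZero m) (hnn : ∀ t, 0 ≤ m t) (h0 : m 0 = 0)
    {p ε γ : ℝ} (hε : 0 < ε) (hγ : 0 < γ) (hp : 1 ≤ p)
    (hloc : ∀ t ∈ Set.Ioo (-ε) ε, ((γ / p * |t| ^ p : ℝ) : EReal) ≤ m t)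
    {lam : ℕ → ℝ} (hpos : ∀ n, 0 < lam n) (hlim : Tendsto lam atTop (𝓝 0))
    (hlam : Memℓp lam (ENNReal.ofReal (p - 1))⁻¹) {b : ℝ} (hb : 0 ≤ b) :
    (∀ᶠ n in atTop, conj m (b * lam n) < ⊤) ∧
      Summable fun n => (lam n)⁻¹ * (conj m (b * lam n)).toReal := by
  have hblim : Tendsto (fun n => b * lam n) atTop (𝓝 0) := by simpa using hlim.const_mul b
  have hbnn : ∀ n, 0 ≤ b * lam n := fun n => mul_nonneg hb (hpos n).le
  suffices H : ∃ h : ℝ → ℝ, (∃ κ > 0, ∀ s, 0 ≤ s → s ≤ κ → conj m s ≤ ((h s : ℝ) : EReal)) ∧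
      Summable fun n => (lam n)⁻¹ * h (b * lam n) by
    obtain ⟨h, ⟨κ, hκ, hle⟩, hsum⟩ := H
    have hev : ∀ᶠ n in atTop, conj m (b * lam n) ≤ ((h (b * lam n) : ℝ) : EReal) := by
      filter_upwards [hblim.eventually_le_const hκ] with n hn using hle _ (hbnn n) hn
    refine ⟨hev.mono fun n hn => hn.trans_lt (EReal.coe_lt_top _), ?_⟩
    refine Summable.of_norm_bounded_eventually_nat hsum ?_
    filter_upwards [hev] with n hn
    have h1 : 0 ≤ (conj m (b * lam n)).toReal := EReal.toReal_nonneg (conj_nonneg_of_zero h0 _)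
    have h2 : 0 < (lam n)⁻¹ := inv_pos.2 (hpos n)
    rw [Real.norm_of_nonneg (by positivity)]
    gcongr
    have := EReal.toReal_le_toReal hn
      (ne_bot_of_le_ne_bot (by simp) (conj_nonneg_of_zero h0 _)) (EReal.coe_ne_top _)
    simpa using this
  rcases hp.eq_or_lt with rfl | hp1
  -- For p = 1 the modulus has a sharp minimum, so its conjugate vanishes near 0 and the errors are
  -- eventually zero.
  · refine ⟨fun _ => 0, exists_conj_bound_of_local_growth hm hnn h0 hε hγ le_rfl hloc
      (fun _ _ => le_rfl) ?_, by simp⟩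
    intro s t _ hs ht
    rw [Real.rpow_one]
    nlinarith
  · set q := p / (p - 1) with hq
    have hp1' : 0 < p - 1 := by linarith
    set B := (γ ^ (-1 / p)) ^ q / q with hB
    have hB0 : 0 ≤ B := by positivity
    refine ⟨fun s => B * s ^ q, exists_conj_bound_of_local_growth hm hnn h0 hε hγ hp hloc
      (fun s hs => by positivity) (fun s t hs _ ht => young_rpow hp1 hγ hs ht), ?_⟩
    have htr : ((ENNReal.ofReal (p - 1))⁻¹).toReal = 1 / (p - 1) := by
      rw [ENNReal.toReal_inv, ENNReal.toReal_ofReal hp1'.le, one_div]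
    have h1 := (memℓp_gen_iff (by rw [htr]; positivity)).1 hlam
    rw [htr] at h1
    -- With q = p/(p-1), λ⁻¹ λ^q = λ^{1/(p-1)}: this is where the summability exponent comes from.
    refine (h1.mul_left (B * b ^ q)).congr fun n => ?_
    have hl := hpos n
    have hq1 : q = 1 / (p - 1) + 1 := by rw [hq]; field_simp; ring
    have h2 : lam n ^ q = lam n ^ (1 / (p - 1)) * lam n := by
      rw [hq1, Real.rpow_add hl, Real.rpow_one]
    simp only [Real.norm_of_nonneg hl.le, Real.mul_rpow hb hl.le, h2]
    field_simp

end Modulus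

/-! ### Real sequences, weak limits and Opial's lemma. -/

section Sequences

/-- The terms with index between n/2 and n are all at least a_n, so n a_n is at most twice the tail
sum from n/2. -/
lemma tendsto_mul_zero_of_antitone_summable {a : ℕ → ℝ} (ha : Antitone a) (hnn : ∀ n, 0 ≤ a n)
    (hs : Summable a) : Tendsto (fun n : ℕ => (n : ℝ) * a n) atTop (𝓝 0) := by
  have hlim : Tendsto (fun n : ℕ => 2 * ∑' k, a (k + n / 2)) atTop (𝓝 0) := by
    have := ((tendsto_sum_nat_add a).comp
      (Nat.tendsto_div_const_atTop two_ne_zero)).const_mul 2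
    simpa using this
  refine tendsto_of_tendsto_of_tendsto_of_le_of_le tendsto_const_nhds hlim
    (fun n => mul_nonneg n.cast_nonneg (hnn n)) (fun n => ?_)
  have h1 : ∑ k ∈ Finset.range (n - n / 2), a (k + n / 2) ≤ ∑' k, a (k + n / 2) :=
    ((summable_nat_add_iff (n / 2)).2 hs).sum_le_tsum _ (fun _ _ => hnn _)
  have h2 : ((n - n / 2 : ℕ) : ℝ) * a n ≤ ∑ k ∈ Finset.range (n - n / 2), a (k + n / 2) := by
    have := Finset.card_nsmul_le_sum (Finset.range (n - n / 2)) (fun k => a (k + n / 2)) (a n)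
      fun k hk => ha (by have := Finset.mem_range.1 hk; omega)
    rwa [Finset.card_range, nsmul_eq_mul] at this
  have h3 : (n : ℝ) ≤ 2 * ((n - n / 2 : ℕ) : ℝ) := by
    exact_mod_cast (by omega : n ≤ 2 * (n - n / 2))
  have h4 := mul_le_mul_of_nonneg_right h3 (hnn n)
  simp only
  linarith

/-- Subtracting the partial sums of the errors leaves a nonincreasing sequence, bounded below. -/
lemma exists_tendsto_of_quasi_decreasing {c e : ℕ → ℝ} {N : ℕ} (hc : ∀ n, 0 ≤ c n)
    (he : ∀ n, 0 ≤ e n) (hs : Summable e) (h : ∀ n, N ≤ n → c (n + 1) ≤ c n + e n) :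
    ∃ l, Tendsto c atTop (𝓝 l) := by
  have hs' : Summable fun n => e (n + N) := (summable_nat_add_iff N).2 hs
  set b : ℕ → ℝ := fun n => c (n + N) - ∑ k ∈ Finset.range n, e (k + N) with hb
  have hanti : Antitone b := by
    refine antitone_nat_of_succ_le fun n => ?_
    have := h (n + N) (by omega)
    simp only [hb, Finset.sum_range_succ]
    rw [show n + 1 + N = n + N + 1 by ring]
    linarith
  have hbdd : BddBelow (Set.range b) := by
    refine ⟨-∑' k, e (k + N), ?_⟩
    rintro _ ⟨n, rfl⟩
    have := hs'.sum_le_tsum (Finset.range n) (fun _ _ => he _)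
    simp only [hb]
    linarith [hc (n + N)]
  have h1 := (tendsto_atTop_ciInf hanti hbdd).add hs'.hasSum.tendsto_sum_nat
  refine ⟨_, (tendsto_add_atTop_iff_nat N).1 (h1.congr fun n => ?_)⟩
  simp [hb]

variable {H : Type*} [NormedAddCommGroup H] [InnerProductSpace ℝ H]

/-- Along an ultrafilter each coefficient converges by compactness of an interval; the limits form a
bounded functional, represented by Riesz. This serves as weak compactness without extracting
subsequences. -/
lemma exists_weak_limit_ultrafilter [CompleteSpace H] {u : ℕ → H} {B : ℝ} (hB : ∀ n, ‖u n‖ ≤ B)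
    (𝒰 : Ultrafilter ℕ) :
    ∃ z : H, ∀ v, Tendsto (fun n => inner ℝ (u n) v) 𝒰 (𝓝 (inner ℝ z v)) := by
  have hbd : ∀ v n, |inner ℝ (u n) v| ≤ B * ‖v‖ := fun v n =>
    (abs_real_inner_le_norm _ _).trans (mul_le_mul_of_nonneg_right (hB n) (norm_nonneg v))
  have hex : ∀ v, ∃ l : ℝ, |l| ≤ B * ‖v‖ ∧ Tendsto (fun n => inner ℝ (u n) v) 𝒰 (𝓝 l) := by
    intro v
    obtain ⟨l, hl, hle⟩ := (isCompact_Icc (a := -(B * ‖v‖)) (b := B * ‖v‖)).ultrafilter_le_nhds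
      (𝒰.map fun n => inner ℝ (u n) v)
      (le_principal_iff.2 (mem_map.2 (univ_mem' fun n => abs_le.1 (hbd v n))))
    exact ⟨l, abs_le.2 hl, hle⟩
  choose l hlb hl using hex
  let L : H →ₗ[ℝ] ℝ :=
    { toFun := l
      map_add' := fun x y => tendsto_nhds_unique (hl (x + y))
        (((hl x).add (hl y)).congr fun n => (inner_add_right _ _ _).symm)
      map_smul' := fun c x => tendsto_nhds_unique (hl (c • x))
        (((hl x).const_mul c).congr fun n => (real_inner_smul_right _ _ _).symm) }
  refine ⟨(InnerProductSpace.toDual ℝ H).symm (L.mkContinuous B hlb), fun v => ?_⟩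
  rw [InnerProductSpace.toDual_symm_apply]
  exact hl v

lemma tendsto_toWeakSpace_of_tendsto_inner [CompleteSpace H] {u : ℕ → H} {z : H}
    (h : ∀ v, Tendsto (fun n => inner ℝ (u n) v) atTop (𝓝 (inner ℝ z v))) :
    Tendsto (fun n => toWeakSpace ℝ H (u n)) atTop (𝓝 (toWeakSpace ℝ H z)) := by
  refine (WeakBilin.tendsto_iff_forall_eval_tendsto (topDualPairing ℝ H).flip ?_).2 fun f => ?_
  · intro x y hxy
    refine ext_inner_left ℝ fun v => ?_
    simpa using congrArg (fun F => F (InnerProductSpace.toDual ℝ H v)) hxy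
  · have h1 : ∀ x, inner ℝ x ((InnerProductSpace.toDual ℝ H).symm f) = f x := fun x => by
      rw [real_inner_comm, InnerProductSpace.toDual_symm_apply]
    have h2 := h ((InnerProductSpace.toDual ℝ H).symm f)
    simp only [h1] at h2
    exact h2

/-- Opial's lemma. -/
lemma exists_weak_limit_of_fejer [CompleteSpace H] {u : ℕ → H} {B : ℝ} (hB : ∀ n, ‖u n‖ ≤ B)
    {S : Set H} (hdist : ∀ z ∈ S, ∃ l, Tendsto (fun n => ‖u n - z‖ ^ 2) atTop (𝓝 l))
    (hclus : ∀ (𝒰 : Ultrafilter ℕ), ↑𝒰 ≤ (atTop : Filter ℕ) → ∀ z : H,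
      (∀ v, Tendsto (fun n => inner ℝ (u n) v) 𝒰 (𝓝 (inner ℝ z v))) → z ∈ S) :
    ∃ z ∈ S, Tendsto (fun n => toWeakSpace ℝ H (u n)) atTop (𝓝 (toWeakSpace ℝ H z)) := by
  obtain ⟨z, hz⟩ := exists_weak_limit_ultrafilter hB (hyperfilter ℕ)
  have hzS := hclus _ Nat.hyperfilter_le_atTop z hz
  refine ⟨z, hzS, tendsto_toWeakSpace_of_tendsto_inner fun v => ?_⟩
  rw [tendsto_iff_ultrafilter]
  intro 𝒰 h𝒰
  obtain ⟨z', hz'⟩ := exists_weak_limit_ultrafilter hB 𝒰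
  have hz'S := hclus _ h𝒰 z' hz'
  suffices z' = z by rw [← this]; exact hz' v
  obtain ⟨l, hl⟩ := hdist z hzS
  obtain ⟨l', hl'⟩ := hdist z' hz'S
  -- The difference of the squared distances to z and z' is affine in u_n, so this inner product
  -- converges along the whole sequence and both cluster points see the same limit.
  have hin : Tendsto (fun n => inner ℝ (u n) (z' - z)) atTop
      (𝓝 ((l - l' - (‖z‖ ^ 2 - ‖z'‖ ^ 2)) / 2)) := by
    refine (((hl.sub hl').sub_const _).div_const 2).congr fun n => ?_
    rw [norm_sub_sq_real, norm_sub_sq_real, inner_sub_right]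
    ring
  have h1 := tendsto_nhds_unique (hz (z' - z)) (hin.mono_left Nat.hyperfilter_le_atTop)
  have h2 := tendsto_nhds_unique (hz' (z' - z)) (hin.mono_left h𝒰)
  have h3 : inner ℝ (z' - z) (z' - z) = 0 := by rw [inner_sub_left, h1, h2, sub_self]
  exact sub_eq_zero.1 (inner_self_eq_zero.1 h3)

end Sequences

/-! ### Conjugates of the data-fit function. -/

section InfConv

variable {H : Type*} [NormedAddCommGroup H] [InnerProductSpace ℝ H]

/-- `(ψ # φ)^* = ψ^* + φ^*` when `ψ` is strongly convex, in terms of real upper bounds. -/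
lemma conj_infConv_le_iff {ψ φ : H → EReal} (hψ : ∀ x, ψ x ≠ ⊥) (hφ : GammaZero φ) {σ : ℝ}
    (hσ : 0 < σ) (hs : ∀ v, ∃ q r, SupportsAt ψ σ v q r) {v : H} {c : ℝ} :
    conj (infConv ψ φ) v ≤ (c : EReal) ↔
      conj φ v ≤ ((c - (conj ψ v).toReal : ℝ) : EReal) := by
  constructor
  · intro h
    obtain ⟨q, r, hq⟩ := hs v
    rw [hq.toReal_conj_eq hσ.le, conj_le_coe_iff]
    intro b t hb
    have h1 : infConv ψ φ (q + b) ≤ ((r + t : ℝ) : EReal) := by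
      refine (iInf_le _ q).trans ?_
      rw [hq.eq, add_sub_cancel_left, EReal.coe_add]
      gcongr
    have h2 := conj_le_coe_iff.1 h _ _ h1
    rw [inner_add_left] at h2
    linarith
  · intro h
    rw [conj_le_coe_iff]
    intro z s hz
    -- The infimal convolution need not be attained, hence an η-optimal splitting of z.
    refine le_of_forall_pos_le_add fun η hη => ?_
    have hlt : infConv ψ φ z < ((s + η : ℝ) : EReal) :=
      hz.trans_lt (by exact_mod_cast lt_add_of_pos_right s hη)
    obtain ⟨a, ha⟩ := iInf_lt_iff.1 hlt
    have ha1 : ψ a ≠ ⊤ := by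
      intro ht
      rw [ht, EReal.top_add_of_ne_bot (hφ.ne_bot _)] at ha
      exact not_top_lt ha
    have ha2 : φ (z - a) ≠ ⊤ := by
      intro ht
      rw [ht, EReal.add_top_of_ne_bot (hψ _)] at ha
      exact not_top_lt ha
    obtain ⟨t, ht⟩ := hφ.exists_coe_eq ha2
    have hr := (EReal.coe_toReal ha1 (hψ a)).symm
    set r := (ψ a).toReal
    rw [hr, ht, ← EReal.coe_add, EReal.coe_lt_coe_iff] at ha
    have h1 := conj_le_coe_iff.1 (coe_toReal_conj hσ hs v).le a r hr.le
    have h2 := conj_le_coe_iff.1 h (z - a) t ht.le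
    rw [inner_sub_left] at h2
    linarith

/-- Makes the approximate dual objectives dominate the exact one. -/
lemma inner_le_of_conj_le {f : H → EReal} {y v : H} {c : ℝ} (hy : f y = 0)
    (h : conj f v ≤ (c : EReal)) : inner ℝ y v ≤ c := by
  simpa using conj_le_coe_iff.1 h y 0 (by simp [hy])

/-- Cauchy–Schwarz reduces the conjugate of m(‖· - y‖) to the scalar conjugate of m; this bounds the
approximation error. -/
lemma conj_le_of_modulus {f : H → EReal} {m : ℝ → EReal} {y v : H} {c : ℝ}
    (hm : ∀ x, m ‖x - y‖ ≤ f x) (h : conj m ‖v‖ ≤ (c : EReal)) :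
    conj f v ≤ ((inner ℝ y v + c : ℝ) : EReal) := by
  refine conj_le_coe_iff.2 fun x s hs => ?_
  have h1 := conj_le_coe_iff.1 h ‖x - y‖ s ((hm x).trans hs)
  simp only [RCLike.inner_apply, conj_trivial] at h1
  have h2 := real_inner_le_norm (x - y) v
  rw [inner_sub_left] at h2
  linarith

/-- Nonnegativity of f gives ⟨x, tv⟩ - f(x) ≤ t(⟨x, v⟩ - f(x)) for t ≤ 1. It yields monotonicity of
the approximate objectives in λ. -/
lemma conj_smul_le {f : H → EReal} (hf : ∀ x, 0 ≤ f x) {v : H} {c t : ℝ} (ht0 : 0 ≤ t)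
    (ht1 : t ≤ 1) (h : conj f v ≤ (c : EReal)) : conj f (t • v) ≤ ((t * c : ℝ) : EReal) := by
  refine conj_le_coe_iff.2 fun x s hs => ?_
  have hs0 : (0 : ℝ) ≤ s := by exact_mod_cast (hf x).trans hs
  have h1 := conj_le_coe_iff.1 h x s hs
  rw [real_inner_smul_right]
  nlinarith

end InfConv

/-! ### The primal problem and the data-fit assumptions. -/

section Primal

variable {X Y : Type*} [NormedAddCommGroup X] [InnerProductSpace ℝ X]
  [NormedAddCommGroup Y] [InnerProductSpace ℝ Y]

/-- A strongly convex function has a minimizer with quadratic growth on a nonempty affine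
constraint set. -/
lemma AssumptionAR.exists_constrained_minimizer [CompleteSpace X] {R : X → EReal} {σR : ℝ} {xbar : X}
    (hAR : AssumptionAR R σR xbar) (A : X →L[ℝ] Y) :
    ∃ (xd : X) (r : ℝ), A xd = A xbar ∧ R xd = r ∧
      ∀ (x : X) (s : ℝ), A x = A xbar → R x ≤ s → r + σR / 2 * ‖x - xd‖ ^ 2 ≤ s := by
  obtain ⟨hσ, ⟨hR, hg⟩, hdom⟩ := hAR
  set g : X → EReal := fun x => R x - ((σR / 2 * ‖x‖ ^ 2 : ℝ) : EReal) with hgdef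
  have hsub : ∀ {x : X} {s : ℝ}, R x ≤ s → g x ≤ ((s - σR / 2 * ‖x‖ ^ 2 : ℝ) : EReal) :=
    fun h => by rw [EReal.coe_sub]; exact EReal.sub_le_sub h le_rfl
  obtain ⟨c, C, hlow⟩ := hg.exists_linear_lower_bound
  obtain ⟨r₀, hr₀⟩ := hR.exists_coe_eq hdom.ne
  -- The constraint is built into the epigraph of g = R - (σR/2)‖·‖²; with zero tilt, the added
  -- quadratic restores R.
  obtain ⟨⟨q, t⟩, ⟨hq1, hq2⟩, hmin⟩ := exists_minimizer_quadratic_perturbation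
    (E := realEpigraph g ∩ {z | A z.1 = A xbar})
    (hg.isClosed_realEpigraph.inter
      (isClosed_eq (A.continuous.comp continuous_fst) continuous_const))
    (hg.convex_realEpigraph.inter fun z hz w hw a b _ _ hab => by
      simp only [Set.mem_ofPred_eq] at hz hw ⊢
      rw [Prod.fst_add, Prod.smul_fst, Prod.smul_fst, map_add, map_smul, map_smul, hz, hw,
        ← add_smul, hab, one_smul])
    ⟨(xbar, r₀ - σR / 2 * ‖xbar‖ ^ 2), hsub hr₀.le, rfl⟩
    (fun z hz => hlow z hz.1) hσ 0
  have hq1' : R q ≤ ((t + σR / 2 * ‖q‖ ^ 2 : ℝ) : EReal) := by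
    have : g q + ((σR / 2 * ‖q‖ ^ 2 : ℝ) : EReal) ≤ t + ((σR / 2 * ‖q‖ ^ 2 : ℝ) : EReal) :=
      add_le_add_left hq1 _
    rwa [hgdef, EReal.sub_add_cancel, ← EReal.coe_add] at this
  have hgrow : ∀ (x : X) (s : ℝ), A x = A xbar → R x ≤ s →
      t + σR / 2 * ‖q‖ ^ 2 + σR / 2 * ‖x - q‖ ^ 2 ≤ s := by
    intro x s hx hs
    have h1 := hmin (x, s - σR / 2 * ‖x‖ ^ 2) ⟨hsub hs, hx⟩
    have h2 : ‖x‖ ^ 2 = ‖q‖ ^ 2 + 2 * inner ℝ q (x - q) + ‖x - q‖ ^ 2 := by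
      rw [← norm_add_sq_real, add_sub_cancel]
    simp only [zero_sub, inner_neg_left, real_inner_smul_left] at h1
    rw [h2] at h1
    linarith
  obtain ⟨r, hr⟩ := hR.exists_coe_eq (ne_top_of_le_ne_top (EReal.coe_ne_top _) hq1')
  have h1 := hgrow q r hq2 hr.le
  have h2 : r ≤ t + σR / 2 * ‖q‖ ^ 2 := by rw [hr] at hq1'; exact_mod_cast hq1'
  refine ⟨q, r, hq2, hr, fun x s hx hs => ?_⟩
  linarith [hgrow x s hx hs]

lemma argmin_dataFit_iff {D J φ : Y → Y → EReal} {σψ p : ℝ} {m : ℝ → EReal} {ybar : Y}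
    (hAD : AssumptionAD D J φ σψ ybar p m) {A : X →L[ℝ] Y} {xbar : X} (hxy : A xbar = ybar)
    (x : X) : (∀ x', D (A x) ybar ≤ D (A x') ybar) ↔ A x = ybar := by
  refine ⟨fun h => ?_, fun h x' => ?_⟩
  · have h1 := h xbar
    rw [(hAD.eq_zero_iff (A xbar) ybar).2 hxy] at h1
    exact (hAD.eq_zero_iff _ _).1 (le_antisymm h1 (hAD.nonneg _ _))
  · rw [(hAD.eq_zero_iff _ _).2 h]
    exact hAD.nonneg _ _

lemma isPrimalSolution_iff {R : X → EReal} {σR : ℝ} (hσ : 0 < σR) {D J φ : Y → Y → EReal}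
    {σψ p : ℝ} {m : ℝ → EReal} {ybar : Y} (hAD : AssumptionAD D J φ σψ ybar p m)
    {A : X →L[ℝ] Y} {xd : X} {r : ℝ} (hA : A xd = ybar) (hr : R xd = r)
    (hmin : ∀ (x : X) (s : ℝ), A x = ybar → R x ≤ s → r + σR / 2 * ‖x - xd‖ ^ 2 ≤ s) (z : X) :
    IsPrimalSolution R D A ybar z ↔ z = xd := by
  simp only [IsPrimalSolution, argmin_dataFit_iff hAD hA]
  constructor
  · rintro ⟨hz, hle⟩
    have h1 := hle xd hA
    rw [hr] at h1
    have h2 := hmin z r hz h1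
    have h3 : ‖z - xd‖ ^ 2 ≤ 0 := by
      have : σR / 2 * ‖z - xd‖ ^ 2 ≤ 0 := by linarith
      exact nonpos_of_mul_nonpos_right this (by positivity)
    have h4 : ‖z - xd‖ = 0 := pow_eq_zero_iff two_ne_zero |>.1 (le_antisymm h3 (sq_nonneg _))
    exact sub_eq_zero.1 (norm_eq_zero.1 h4)
  · rintro rfl
    refine ⟨hA, fun x hx => EReal.le_of_forall_lt_iff_le.1 fun s hs => ?_⟩
    rw [hr, EReal.coe_le_coe_iff]
    have := hmin x s hx hs.le
    have : 0 ≤ σR / 2 * ‖x - z‖ ^ 2 := by positivity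
    linarith

lemma AssumptionAD.psi_ne_bot {D J φ : Y → Y → EReal} {σψ p : ℝ} {m : ℝ → EReal}
    {ybar : Y} (hAD : AssumptionAD D J φ σψ ybar p m) (x : Y) : psi J σψ ybar x ≠ ⊥ := by
  rw [psi, Ne, EReal.add_eq_bot_iff, not_or]
  exact ⟨(hAD.J_mem ybar).ne_bot x, EReal.coe_ne_bot _⟩

lemma AssumptionAD.modulus_le {D J φ : Y → Y → EReal} {σψ p : ℝ} {m : ℝ → EReal}
    {ybar : Y} (hAD : AssumptionAD D J φ σψ ybar p m) (x : Y) : m ‖x - ybar‖ ≤ D x ybar := by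
  obtain ⟨⟨-, -, -, -, x₀, hx₀, hm⟩, -⟩ := hAD.conditioned
  have h0 : D ybar ybar = 0 := (hAD.eq_zero_iff _ _).2 rfl
  -- The unique minimizer in the conditioning assumption is ybar, where D vanishes.
  obtain rfl : ybar = x₀ := (hx₀ ybar).1 fun x' => h0.trans_le (hAD.nonneg _ _)
  simpa [h0] using hm x

lemma AssumptionAD.modulus_zero {D J φ : Y → Y → EReal} {σψ p : ℝ} {m : ℝ → EReal}
    {ybar : Y} (hAD : AssumptionAD D J φ σψ ybar p m) : m 0 = 0 := by
  have h := hAD.modulus_le ybar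
  rw [sub_self, norm_zero, (hAD.eq_zero_iff _ _).2 rfl] at h
  exact le_antisymm h (hAD.conditioned.1.2.1 0)

end Primal

/-! ### The dual objective, duality gap and source condition. -/

section Dual

open ContinuousLinearMap

variable {X Y : Type*} [NormedAddCommGroup X] [InnerProductSpace ℝ X] [CompleteSpace X]
  [NormedAddCommGroup Y] [InnerProductSpace ℝ Y] [CompleteSpace Y]

/-- The dual objective as a real-valued function. -/
noncomputable def dualReal (R : X → EReal) (A : X →L[ℝ] Y) (ybar u : Y) : ℝ :=
  (conj R (-(adjoint A u))).toReal + inner ℝ ybar u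

variable {R : X → EReal} {σR : ℝ} {A : X →L[ℝ] Y} {ybar : Y}

lemma toReal_conj_adjoint_ge_linear (hσ : 0 < σR) (hs : ∀ v, ∃ q r, SupportsAt R σR v q r)
    (u z : Y) :
    (conj R (-(adjoint A u))).toReal +
        inner ℝ (-(A (gradConj R (-(adjoint A u))))) (z - u) ≤
      (conj R (-(adjoint A z))).toReal := by
  have h := toReal_conj_ge_linear hσ hs (-(adjoint A u)) (-(adjoint A z))
  have e : -(adjoint A z) - -(adjoint A u) = -(adjoint A (z - u)) := by rw [map_sub]; abel
  rwa [e, inner_neg_right, adjoint_inner_right, ← inner_neg_left] at h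

lemma toReal_conj_adjoint_le_quadratic (hσ : 0 < σR)
    (hs : ∀ v, ∃ q r, SupportsAt R σR v q r) (u z : Y) :
    (conj R (-(adjoint A z))).toReal ≤
      (conj R (-(adjoint A u))).toReal +
        inner ℝ (-(A (gradConj R (-(adjoint A u))))) (z - u) +
        ‖A‖ ^ 2 / σR / 2 * ‖z - u‖ ^ 2 := by
  have h := toReal_conj_le_quadratic hσ hs (-(adjoint A u)) (-(adjoint A z))
  have e : -(adjoint A z) - -(adjoint A u) = -(adjoint A (z - u)) := by rw [map_sub]; abel
  rw [e, inner_neg_right, adjoint_inner_right, ← inner_neg_left, norm_neg] at h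
  have h1 : ‖adjoint A (z - u)‖ ≤ ‖A‖ * ‖z - u‖ := by
    simpa using (adjoint A).le_opNorm (z - u)
  have h2 : 1 / (2 * σR) * ‖adjoint A (z - u)‖ ^ 2 ≤ 1 / (2 * σR) * (‖A‖ * ‖z - u‖) ^ 2 := by
    gcongr
  have h3 : 1 / (2 * σR) * (‖A‖ * ‖z - u‖) ^ 2 = ‖A‖ ^ 2 / σR / 2 * ‖z - u‖ ^ 2 := by
    field_simp
  linarith

lemma dualReal_ge_linear (hσ : 0 < σR) (hs : ∀ v, ∃ q r, SupportsAt R σR v q r) (u z : Y) :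
    dualReal R A ybar u + inner ℝ (ybar - A (gradConj R (-(adjoint A u)))) (z - u) ≤
      dualReal R A ybar z := by
  have h := toReal_conj_adjoint_ge_linear (A := A) hσ hs u z
  simp only [dualReal, inner_sub_left, inner_sub_right, inner_neg_left] at h ⊢
  linarith

lemma dualReal_le_quadratic (hσ : 0 < σR) (hs : ∀ v, ∃ q r, SupportsAt R σR v q r) (u z : Y) :
    dualReal R A ybar z ≤
      dualReal R A ybar u + inner ℝ (ybar - A (gradConj R (-(adjoint A u)))) (z - u) +
        ‖A‖ ^ 2 / σR / 2 * ‖z - u‖ ^ 2 := by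
  have h := toReal_conj_adjoint_le_quadratic (A := A) hσ hs u z
  simp only [dualReal, inner_sub_left, inner_sub_right, inner_neg_left] at h ⊢
  linarith

lemma isDualSolution_iff (hσ : 0 < σR) (hs : ∀ v, ∃ q r, SupportsAt R σR v q r) (u : Y) :
    IsDualSolution R A ybar u ↔ ∀ v, dualReal R A ybar u ≤ dualReal R A ybar v := by
  have h : ∀ v, dualObjective R A ybar v = ((dualReal R A ybar v : ℝ) : EReal) := fun v => by
    rw [dualObjective, coe_toReal_conj hσ hs, ← EReal.coe_add, dualReal]
  simp only [IsDualSolution, h, EReal.coe_le_coe_iff]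

/-- The dual gap controls the distance of the associated primal point to the primal solution. -/
lemma sq_dist_le_dual_gap (hσ : 0 < σR) (hs : ∀ v, ∃ q r, SupportsAt R σR v q r) {xd : X} {r : ℝ}
    (hA : A xd = ybar) (hr : R xd = r) (u : Y) :
    σR / 2 * ‖gradConj R (-(adjoint A u)) - xd‖ ^ 2 ≤ dualReal R A ybar u + r := by
  obtain ⟨t, h⟩ := exists_supportsAt_gradConj hσ hs (-(adjoint A u))
  -- Strong convexity of R at the primal point attached to u, tested at the primal solution.
  have h1 := h.le xd r hr.le
  rw [dualReal, h.toReal_conj_eq hσ.le, norm_sub_rev]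
  simp only [inner_neg_left, inner_neg_right, inner_sub_right, adjoint_inner_left,
    adjoint_inner_right, hA] at h1 ⊢
  rw [real_inner_comm u ybar, real_inner_comm u (A _)]
  linarith

lemma isDualSolution_of_dualReal_eq (hσ : 0 < σR) (hs : ∀ v, ∃ q r, SupportsAt R σR v q r)
    {xd : X} {r : ℝ} (hA : A xd = ybar) (hr : R xd = r) {u : Y}
    (hu : dualReal R A ybar u = -r) : IsDualSolution R A ybar u := by
  rw [isDualSolution_iff hσ hs]
  intro v
  have h1 := sq_dist_le_dual_gap hσ hs hA hr v
  have h2 : 0 ≤ σR / 2 * ‖gradConj R (-(adjoint A v)) - xd‖ ^ 2 := by positivity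
  linarith

/-- The dual objective is differentiable with gradient ybar - A∇R^*(-A^*u), which vanishes at a
minimizer: dual optimality is primal feasibility. -/
lemma IsDualSolution.map_gradConj_eq (hσ : 0 < σR) (hs : ∀ v, ∃ q r, SupportsAt R σR v q r)
    {u : Y} (hu : IsDualSolution R A ybar u) : A (gradConj R (-(adjoint A u))) = ybar := by
  rw [isDualSolution_iff hσ hs] at hu
  have hg : HasGradientAt (dualReal R A ybar) (ybar - A (gradConj R (-(adjoint A u)))) u :=
    hasGradientAt_of_quadratic_bounds (dualReal_ge_linear hσ hs u) (dualReal_le_quadratic hσ hs u)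
  have h0 := IsLocalMin.hasFDerivAt_eq_zero (Eventually.of_forall hu) hg.hasFDerivAt
  rw [LinearIsometryEquiv.map_eq_zero_iff] at h0
  exact (sub_eq_zero.1 h0).symm

/-- The point x = ∇R^*(-A^*u) is feasible, so the linear term ⟨-A^*u, xd - x⟩ vanishes. Adding the
growth of R around x to the constrained growth around xd forces x = xd. -/
lemma supportsAt_of_isDualSolution (hσ : 0 < σR) (hs : ∀ v, ∃ q r, SupportsAt R σR v q r) {xd : X}
    {r : ℝ} (hr : R xd = r)
    (hmin : ∀ (x : X) (s : ℝ), A x = ybar → R x ≤ s → r + σR / 2 * ‖x - xd‖ ^ 2 ≤ s)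
    (hA : A xd = ybar) {u : Y} (hu : IsDualSolution R A ybar u) :
    SupportsAt R σR (-(adjoint A u)) xd r := by
  obtain ⟨t, h⟩ := exists_supportsAt_gradConj hσ hs (-(adjoint A u))
  have hx := hu.map_gradConj_eq hσ hs
  set x := gradConj R (-(adjoint A u))
  have h1 := h.le xd r hr.le
  have h2 := hmin x t hx h.eq.le
  have h3 : inner ℝ (-(adjoint A u)) (xd - x) = 0 := by
    rw [inner_neg_left, adjoint_inner_left, map_sub, hA, hx, sub_self, inner_zero_right, neg_zero]
  rw [h3, norm_sub_rev] at h1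
  have h4 : ‖x - xd‖ ^ 2 ≤ 0 := by
    have : σR * ‖x - xd‖ ^ 2 ≤ 0 := by linarith
    exact nonpos_of_mul_nonpos_right this hσ
  have h5 : ‖x - xd‖ = 0 := pow_eq_zero_iff two_ne_zero |>.1 (le_antisymm h4 (sq_nonneg _))
  have h6 : x = xd := sub_eq_zero.1 (norm_eq_zero.1 h5)
  rw [h6] at h
  have h7 : t = r := by have := h.eq.symm.trans hr; exact_mod_cast this
  rwa [h7] at h

lemma dualReal_eq_of_supportsAt {σ : ℝ} (hσ : 0 ≤ σ) {xd : X} {r : ℝ} (hA : A xd = ybar) {u : Y}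
    (h : SupportsAt R σ (-(adjoint A u)) xd r) : dualReal R A ybar u = -r := by
  rw [dualReal, h.toReal_conj_eq hσ, inner_neg_right, adjoint_inner_right, hA]
  ring

/-- By Fenchel equality, A^*u is a subgradient of R at xd exactly when -u closes the duality gap;
note the sign change. -/
lemma sourceCondition_iff_exists_isDualSolution (hσ : 0 < σR)
    (hs : ∀ v, ∃ q r, SupportsAt R σR v q r) {xd : X} {r : ℝ} (hA : A xd = ybar) (hr : R xd = r)
    (hmin : ∀ (x : X) (s : ℝ), A x = ybar → R x ≤ s → r + σR / 2 * ‖x - xd‖ ^ 2 ≤ s) :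
    SourceCondition R A xd ↔ ∃ u, IsDualSolution R A ybar u := by
  constructor
  · rintro ⟨_, hv, u, rfl⟩
    refine ⟨-u, isDualSolution_of_dualReal_eq hσ hs hA hr
      (dualReal_eq_of_supportsAt le_rfl hA ?_)⟩
    rw [map_neg, neg_neg]
    exact (supportsAt_zero_iff_mem_subdifferential hr).2 hv
  · rintro ⟨u, hu⟩
    have h := supportsAt_of_isDualSolution hσ hs hr hmin hA hu
    refine ⟨-(adjoint A u), ?_, -u, map_neg _ _⟩
    refine (supportsAt_zero_iff_mem_subdifferential hr).1 ⟨hr, fun x s hx => ?_⟩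
    have h1 := h.le x s hx
    have h2 : 0 ≤ σR / 2 * ‖x - xd‖ ^ 2 := by positivity
    linarith

end Dual

/-! ### The forward-backward step and its energy inequality. -/

section Iteration

open ContinuousLinearMap

/-- The three-point inequality for one forward-backward step. -/
lemma forward_backward_inequality {Y : Type*} [NormedAddCommGroup Y] [InnerProductSpace ℝ Y]
    {S P : Y → ℝ} {u u' z gS gP q : Y} {τ l L₁ L₂ b c : ℝ} (hτ : 0 < τ) (hl : 0 < l)
    (hL : τ * (L₁ + l * L₂) ≤ 1)
    (hS : S u + inner ℝ gS (z - u) ≤ S z)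
    (hS' : S u' ≤ S u + inner ℝ gS (u' - u) + L₁ / 2 * ‖u' - u‖ ^ 2)
    (hP : P (l • u) + inner ℝ gP (l • z - l • u) ≤ P (l • z))
    (hP' : P (l • u') ≤
      P (l • u) + inner ℝ gP (l • u' - l • u) + L₂ / 2 * ‖l • u' - l • u‖ ^ 2)
    (hq : b + inner ℝ q (l • z - l • u') ≤ c)
    (hstep : u' = u - τ • (gS + gP + q)) :
    2 * τ * (S u' + l⁻¹ * (P (l • u') + b) - (S z + l⁻¹ * (P (l • z) + c))) ≤
      ‖u - z‖ ^ 2 - ‖u' - z‖ ^ 2 := by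
  rw [← smul_sub, real_inner_smul_right] at hP hP' hq
  rw [norm_smul, mul_pow, Real.norm_of_nonneg hl.le] at hP'
  have hd : τ • (gS + gP + q) = u - u' := by rw [hstep]; abel
  have hin : τ * (inner ℝ gS (z - u') + inner ℝ gP (z - u') + inner ℝ q (z - u')) =
      inner ℝ (u - u') (z - u') := by
    rw [← inner_add_left, ← inner_add_left, ← real_inner_smul_left, hd]
  have hS1 : inner ℝ gS (z - u) - inner ℝ gS (u' - u) = inner ℝ gS (z - u') := by
    rw [← inner_sub_right, sub_sub_sub_cancel_right]
  have hP1 : inner ℝ gP (z - u) - inner ℝ gP (u' - u) = inner ℝ gP (z - u') := by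
    rw [← inner_sub_right, sub_sub_sub_cancel_right]
  have hn : ‖u - z‖ ^ 2 = ‖u' - u‖ ^ 2 - 2 * inner ℝ (u - u') (z - u') + ‖u' - z‖ ^ 2 := by
    rw [norm_sub_rev u' u, norm_sub_rev u' z, ← norm_sub_sq_real, sub_sub_sub_cancel_right]
  have hPq : l⁻¹ * (P (l • u') + b) - l⁻¹ * (P (l • z) + c) ≤
      -(inner ℝ gP (z - u') + inner ℝ q (z - u')) + l * L₂ / 2 * ‖u' - u‖ ^ 2 := by
    rw [← mul_sub, inv_mul_le_iff₀ hl]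
    linear_combination hP + hP' + hq - l * hP1
  have hmain : S u' + l⁻¹ * (P (l • u') + b) - (S z + l⁻¹ * (P (l • z) + c)) ≤
      -(inner ℝ gS (z - u') + inner ℝ gP (z - u') + inner ℝ q (z - u')) +
        (L₁ + l * L₂) / 2 * ‖u' - u‖ ^ 2 := by
    linear_combination hPq + hS + hS' - hS1
  -- The quadratic remainder τ(L₁ + lL₂)‖u' - u‖² is absorbed by the ‖u' - u‖² term of `hn`.
  have h2 := mul_le_mul_of_nonneg_left hmain (by positivity : 0 ≤ 2 * τ)
  have h3 := mul_le_mul_of_nonneg_right hL (sq_nonneg ‖u' - u‖)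
  rw [hn]
  linear_combination h2 + h3 - 2 * hin

variable {X Y : Type*} [NormedAddCommGroup X] [InnerProductSpace ℝ X] [CompleteSpace X]
  [NormedAddCommGroup Y] [InnerProductSpace ℝ Y] [CompleteSpace Y]

lemma AssumptionAD.exists_supportsAt_psi {D J φ : Y → Y → EReal} {σψ p : ℝ} {m : ℝ → EReal}
    {ybar : Y} (hAD : AssumptionAD D J φ σψ ybar p m) (v : Y) :
    ∃ q r, SupportsAt (psi J σψ ybar) σψ v q r :=
  (hAD.J_mem ybar).exists_supportsAt_add_sq hAD.σψ_pos (fun _ => rfl) v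

/-- One step of the method decreases the distance to any point up to the approximation error. -/
lemma exists_step_value {R : X → EReal} {σR : ℝ} (hσR : 0 < σR)
    (hs : ∀ v, ∃ q r, SupportsAt R σR v q r) {A : X →L[ℝ] Y} {ybar : Y}
    {D J φ : Y → Y → EReal} {σψ p : ℝ} {m : ℝ → EReal}
    (hAD : AssumptionAD D J φ σψ ybar p m) {lam : ℕ → ℝ} {τ : ℝ} {x : ℕ → X} {w u : ℕ → Y}
    (hit : IsDiagonalDualDescent R σR A J φ σψ ybar lam τ x w u) (n : ℕ) :
    ∃ b : ℝ, conj (fun v => D v ybar) (lam n • u (n + 1)) ≤ (b : EReal) ∧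
      ∀ (z : Y) (c : ℝ), conj (fun v => D v ybar) (lam n • z) ≤ (c : EReal) →
        2 * τ * ((conj R (-(adjoint A (u (n + 1))))).toReal + (lam n)⁻¹ * b -
            ((conj R (-(adjoint A z))).toReal + (lam n)⁻¹ * c)) ≤
          ‖u n - z‖ ^ 2 - ‖u (n + 1) - z‖ ^ 2 := by
  have hl := hit.lam_pos n
  have hτ := hit.τ_pos
  have hσψ := hAD.σψ_pos
  have hD : (fun v => D v ybar) = infConv (psi J σψ ybar) (φ ybar) :=
    funext fun v => hAD.decomp ybar v
  have hiff : ∀ {v : Y} {c : ℝ}, conj (fun v => D v ybar) v ≤ (c : EReal) ↔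
      conj (φ ybar) v ≤ ((c - (conj (psi J σψ ybar) v).toReal : ℝ) : EReal) := by
    intro v c
    rw [hD]
    exact conj_infConv_le_iff hAD.psi_ne_bot (hAD.φ_mem ybar) hσψ hAD.exists_supportsAt_psi
  obtain ⟨r, hprox⟩ := (hAD.φ_mem ybar).exists_supportsAt_prox
    (c := (τ * lam n)⁻¹) (by positivity) (τ⁻¹ • w (n + 1))
  set q := prox (fun v => (((τ * lam n)⁻¹ : ℝ) : EReal) * φ ybar v) (τ⁻¹ • w (n + 1)) with hq
  have hu : u (n + 1) = w (n + 1) - τ • q := hit.u_eq n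
  -- Moreau's decomposition: optimality of q puts λ_n u_{n+1} in ∂φ(q), so q acts as a subgradient
  -- of φ^* at the new iterate and the step is implicit in φ^*.
  have hv : ((τ * lam n)⁻¹)⁻¹ • (τ⁻¹ • w (n + 1) - q) = lam n • u (n + 1) := by
    rw [hu, inv_inv, smul_sub, smul_smul, smul_sub, smul_smul]
    congr 2
    · field_simp
    · ring
  rw [hv] at hprox
  set P : Y → ℝ := fun v => (conj (psi J σψ ybar) v).toReal with hPdef
  set S : Y → ℝ := fun v => (conj R (-(adjoint A v))).toReal with hSdef
  set b₀ := (conj (φ ybar) (lam n • u (n + 1))).toReal with hb₀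
  refine ⟨P (lam n • u (n + 1)) + b₀, ?_, fun z c hc => ?_⟩
  · rw [hiff, add_sub_cancel_left, hb₀, hprox.conj_eq le_rfl, EReal.toReal_coe]
  · have hL : τ * (‖A‖ ^ 2 / σR + lam n * (1 / σψ)) ≤ 1 := by
      have h0 : 0 < ‖A‖ ^ 2 / σR + lam 0 / σψ :=
        add_pos_of_nonneg_of_pos (by positivity) (div_pos (hit.lam_pos 0) hσψ)
      have h1 := (le_div_iff₀ h0).1 hit.τ_le
      have h2 : lam n * (1 / σψ) ≤ lam 0 / σψ := by
        rw [mul_one_div]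
        exact div_le_div_of_nonneg_right (hit.lam_antitone n.zero_le) hσψ.le
      exact (mul_le_mul_of_nonneg_left (by linarith) hτ.le).trans h1
    have hc' : conj (φ ybar) (lam n • z) ≤ ((c - P (lam n • z) : ℝ) : EReal) := hiff.1 hc
    have hstep : u (n + 1) =
        u n - τ • (-(A (x n)) + gradConj (psi J σψ ybar) (lam n • u n) + q) := by
      rw [hu, hit.w_eq n]
      module
    rw [hit.x_eq n] at hstep
    have hP' := toReal_conj_le_quadratic hσψ hAD.exists_supportsAt_psi (lam n • u n)
      (lam n • u (n + 1))
    have h := forward_backward_inequality (S := S) (P := P) hτ hl hL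
      (toReal_conj_adjoint_ge_linear hσR hs (u n) z)
      (toReal_conj_adjoint_le_quadratic hσR hs (u n) (u (n + 1)))
      (toReal_conj_ge_linear hσψ hAD.exists_supportsAt_psi (lam n • u n) (lam n • z))
      (by rw [div_div, mul_comm σψ 2]; exact hP')
      (hprox.linear_le_conj le_rfl hc') hstep
    rwa [add_sub_cancel] at h

/-- The values of the approximate dual objectives along the iterates are nonincreasing, dominate
the dual objective, and satisfy a Fejér-type inequality. -/
lemma exists_dual_values {R : X → EReal} {σR : ℝ} (hσR : 0 < σR)
    (hs : ∀ v, ∃ q r, SupportsAt R σR v q r) {A : X →L[ℝ] Y} {ybar : Y}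
    {D J φ : Y → Y → EReal} {σψ p : ℝ} {m : ℝ → EReal}
    (hAD : AssumptionAD D J φ σψ ybar p m) {lam : ℕ → ℝ} {τ : ℝ} {x : ℕ → X} {w u : ℕ → Y}
    (hit : IsDiagonalDualDescent R σR A J φ σψ ybar lam τ x w u) :
    ∃ a : ℕ → ℝ, Antitone a ∧ (∀ n, dualReal R A ybar (u (n + 1)) ≤ a n) ∧
      ∀ n z, conj m (‖z‖ * lam n) < ⊤ →
        ‖u (n + 1) - z‖ ^ 2 + 2 * τ * (a n - dualReal R A ybar z) ≤
          ‖u n - z‖ ^ 2 + 2 * τ * ((lam n)⁻¹ * (conj m (‖z‖ * lam n)).toReal) := by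
  choose b hb hstep using exists_step_value hσR hs hAD hit
  have hτ := hit.τ_pos
  have hy0 : D ybar ybar = 0 := (hAD.eq_zero_iff _ _).2 rfl
  -- The n-th approximate objective is evaluated at the new iterate u_{n+1}.
  refine ⟨fun n => (conj R (-(adjoint A (u (n + 1))))).toReal + (lam n)⁻¹ * b n,
    antitone_nat_of_succ_le fun n => ?_, fun n => ?_, fun n z hz => ?_⟩
  · have hl := hit.lam_pos n
    have hl' := hit.lam_pos (n + 1)
    -- Passing from λ_n to λ_{n+1} lowers the objective at u_{n+1}; step n+1 compared with z =
    -- u_{n+1} then lowers it further.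
    have h1 := conj_smul_le (fun v => hAD.nonneg v ybar) (t := lam (n + 1) / lam n)
      (by positivity) ((div_le_one hl).2 (hit.lam_antitone n.le_succ)) (hb n)
    rw [smul_smul, div_mul_cancel₀ _ hl.ne'] at h1
    have h2 := hstep (n + 1) _ _ h1
    rw [sub_self, norm_zero] at h2
    have e : (lam (n + 1))⁻¹ * (lam (n + 1) / lam n * b n) = (lam n)⁻¹ * b n := by field_simp
    rw [e] at h2
    have h3 := nonpos_of_mul_nonpos_right 
      (h2.trans (by nlinarith [sq_nonneg ‖u (n + 2) - u (n + 1)‖])) (by positivity : 0 < 2 * τ)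
    linarith
  · have h1 := inner_le_of_conj_le (f := fun v => D v ybar) hy0 (hb n)
    rw [real_inner_smul_right] at h1
    have h2 : inner ℝ ybar (u (n + 1)) ≤ (lam n)⁻¹ * b n := by
      rw [le_inv_mul_iff₀ (hit.lam_pos n)]
      exact h1
    simp only [dualReal]
    linarith
  · have hl := hit.lam_pos n
    have hnorm : ‖lam n • z‖ = ‖z‖ * lam n := by
      rw [norm_smul, Real.norm_of_nonneg hl.le, mul_comm]
    have hm := hAD.conditioned.1.1.exists_conj_eq hz.ne
    have h1 := conj_le_of_modulus (v := lam n • z) hAD.modulus_le (by rw [hnorm]; exact hm.le)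
    have h2 := hstep n z _ h1
    rw [real_inner_smul_right, mul_add, inv_mul_cancel_left₀ hl.ne'] at h2
    simp only [dualReal]
    linarith

end Iteration

/-! ### Consequences of the energy inequality. -/

section Convergence

variable {Y : Type*} [NormedAddCommGroup Y]

lemma sum_gap_le {u : ℕ → Y} {z : Y} {a e : ℕ → ℝ} {d τ : ℝ} {N : ℕ} (hτ : 0 < τ)
    (h : ∀ n, N ≤ n →
      ‖u (n + 1) - z‖ ^ 2 + 2 * τ * (a n - d) ≤ ‖u n - z‖ ^ 2 + 2 * τ * e n) (k : ℕ) :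
    ∑ i ∈ Finset.range k, (a (N + i) - d) ≤
      1 / (2 * τ) * ‖u N - z‖ ^ 2 + ∑ i ∈ Finset.range k, e (N + i) := by
  have key : ‖u (N + k) - z‖ ^ 2 + 2 * τ * ∑ i ∈ Finset.range k, (a (N + i) - d) ≤
      ‖u N - z‖ ^ 2 + 2 * τ * ∑ i ∈ Finset.range k, e (N + i) := by
    induction k with
    | zero => simp
    | succ k ih =>
      have h1 := h (N + k) (by omega)
      rw [Finset.sum_range_succ, Finset.sum_range_succ, ← add_assoc N k 1]
      linarith
  have h1 : 2 * τ * ∑ i ∈ Finset.range k, (a (N + i) - d) ≤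
      2 * τ * (1 / (2 * τ) * ‖u N - z‖ ^ 2 + ∑ i ∈ Finset.range k, e (N + i)) := by
    have e1 : 2 * τ * (1 / (2 * τ) * ‖u N - z‖ ^ 2 + ∑ i ∈ Finset.range k, e (N + i)) =
        ‖u N - z‖ ^ 2 + 2 * τ * ∑ i ∈ Finset.range k, e (N + i) := by field_simp
    rw [e1]
    linarith [sq_nonneg ‖u (N + k) - z‖]
  exact le_of_mul_le_mul_left h1 (by positivity)

/-- After telescoping, monotonicity of a bounds each of the k + 1 summed gaps below by the last one.
-/
lemma mul_gap_le_tsum {u : ℕ → Y} {z : Y} {a e : ℕ → ℝ} {d τ : ℝ} {N : ℕ} (hτ : 0 < τ)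
    (ha : Antitone a) (he : ∀ n, 0 ≤ e n) (hsum : Summable e)
    (h : ∀ n, N ≤ n →
      ‖u (n + 1) - z‖ ^ 2 + 2 * τ * (a n - d) ≤ ‖u n - z‖ ^ 2 + 2 * τ * e n) (k : ℕ) :
    ((k : ℝ) + 1) * (a (N + k) - d) ≤
      1 / (2 * τ) * ‖u N - z‖ ^ 2 + ∑' i, e (N + i) := by
  have h1 := sum_gap_le hτ h (k + 1)
  have h2 : ∑ i ∈ Finset.range (k + 1), e (N + i) ≤ ∑' i, e (N + i) := by
    refine Summable.sum_le_tsum _ (fun _ _ => he _) ?_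
    simpa only [add_comm N] using (summable_nat_add_iff N).2 hsum
  have h3 := Finset.card_nsmul_le_sum (Finset.range (k + 1)) (fun i => a (N + i) - d)
    (a (N + k) - d) fun i hi => sub_le_sub_right
      (ha (by have := Finset.mem_range.1 hi; omega)) _
  rw [Finset.card_range, nsmul_eq_mul, Nat.cast_add_one] at h3
  linarith

/-- Here d need not bound a from below, so z may be any point; the conclusion is limsup a ≤ d even
before a dual solution is known to exist. -/
lemma eventually_le_add_of_gap {u : ℕ → Y} {z : Y} {a e : ℕ → ℝ} {d τ : ℝ} (hτ : 0 < τ)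
    (ha : Antitone a) (he : ∀ n, 0 ≤ e n) (hsum : Summable e)
    (h : ∀ᶠ n in atTop,
      ‖u (n + 1) - z‖ ^ 2 + 2 * τ * (a n - d) ≤ ‖u n - z‖ ^ 2 + 2 * τ * e n)
    {δ : ℝ} (hδ : 0 < δ) : ∀ᶠ n in atTop, a n ≤ d + δ := by
  obtain ⟨N, hN⟩ := eventually_atTop.1 h
  obtain ⟨k, hk⟩ := exists_nat_gt ((1 / (2 * τ) * ‖u N - z‖ ^ 2 + ∑' i, e (N + i)) / δ)
  rw [div_lt_iff₀ hδ] at hk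
  have h1 : a (N + k) ≤ d + δ := by
    by_contra! hlt
    have h2 := mul_gap_le_tsum hτ ha he hsum hN k
    have h3 : (k : ℝ) * δ ≤ ((k : ℝ) + 1) * (a (N + k) - d) :=
      mul_le_mul (by linarith) (by linarith) hδ.le (by positivity)
    linarith
  filter_upwards [eventually_ge_atTop (N + k)] with n hn using (ha hn).trans h1

lemma summable_gap {u : ℕ → Y} {z : Y} {a e : ℕ → ℝ} {d τ : ℝ} (hτ : 0 < τ)
    (hd : ∀ n, d ≤ a n) (he : ∀ n, 0 ≤ e n) (hsum : Summable e)
    (h : ∀ᶠ n in atTop,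
      ‖u (n + 1) - z‖ ^ 2 + 2 * τ * (a n - d) ≤ ‖u n - z‖ ^ 2 + 2 * τ * e n) :
    Summable fun n => a n - d := by
  obtain ⟨N, hN⟩ := eventually_atTop.1 h
  have hsum' : Summable fun i => e (N + i) := by
    simpa only [add_comm N] using (summable_nat_add_iff N).2 hsum
  refine (summable_nat_add_iff N).1 ?_
  refine summable_of_sum_range_le (c := 1 / (2 * τ) * ‖u N - z‖ ^ 2 + ∑' i, e (N + i))
    (fun n => sub_nonneg.2 (hd _)) fun k => ?_
  have h1 := sum_gap_le hτ hN k
  have h2 := hsum'.sum_le_tsum (Finset.range k) (fun _ _ => he _)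
  simp only [add_comm _ N]
  linarith

lemma isLittleO_rpow_of_tendsto_mul_sq {c : ℕ → ℝ} (hc : ∀ n, 0 ≤ c n)
    (h : Tendsto (fun n : ℕ => (n : ℝ) * c n ^ 2) atTop (𝓝 0)) :
    c =o[atTop] fun n : ℕ => (n : ℝ) ^ (-(1 / 2) : ℝ) := by
  refine Asymptotics.isLittleO_iff.2 fun δ hδ => ?_
  filter_upwards [h.eventually_le_const (by positivity : 0 < δ ^ 2), eventually_gt_atTop 0]
    with n hn hn0
  have hn0' : (0 : ℝ) < n := by exact_mod_cast hn0
  rw [Real.norm_of_nonneg (hc n), Real.norm_of_nonneg (by positivity), Real.rpow_neg hn0'.le,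
    ← Real.sqrt_eq_rpow, ← div_eq_mul_inv, le_div_iff₀ (Real.sqrt_pos.2 hn0')]
  refine abs_le_of_sq_le_sq' ?_ hδ.le |>.2
  rw [mul_pow, Real.sq_sqrt hn0'.le, mul_comm]
  exact hn

lemma tendsto_of_isLittleO_rpow {X : Type*} [NormedAddCommGroup X] {x : ℕ → X} {xd : X}
    (h : (fun n => ‖x n - xd‖) =o[atTop] fun n : ℕ => (n : ℝ) ^ (-(1 / 2) : ℝ)) :
    Tendsto x atTop (𝓝 xd) := by
  rw [tendsto_iff_norm_sub_tendsto_zero]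
  exact h.isBigO.trans_tendsto
    ((tendsto_rpow_neg_atTop (by norm_num : (0 : ℝ) < 1 / 2)).comp tendsto_natCast_atTop_atTop)

lemma isBounded_range_of_tendsto_sq_dist {u : ℕ → Y} {z : Y} {l : ℝ}
    (h : Tendsto (fun n => ‖u n - z‖ ^ 2) atTop (𝓝 l)) : Bornology.IsBounded (Set.range u) := by
  obtain ⟨C, hC⟩ := isBounded_iff_forall_norm_le.1 (Metric.isBounded_range_of_tendsto _ h)
  refine isBounded_iff_forall_norm_le.2 ⟨√C + ‖z‖, ?_⟩
  rintro _ ⟨n, rfl⟩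
  have h1 := hC _ ⟨n, rfl⟩
  rw [Real.norm_of_nonneg (by positivity)] at h1
  have h2 : ‖u n - z‖ ≤ √C := Real.le_sqrt_of_sq_le h1
  have h3 : ‖u n‖ ≤ ‖u n - z‖ + ‖z‖ := by simpa using norm_add_le (u n - z) z
  linarith

end Convergence

end DualDescent

/-! ### The main theorem. -/

open DualDescent Filter Topology

theorem theorem1 {X Y : Type*}
    [NormedAddCommGroup X] [InnerProductSpace ℝ X] [CompleteSpace X]
    [NormedAddCommGroup Y] [InnerProductSpace ℝ Y] [CompleteSpace Y]
    (A : X →L[ℝ] Y) (xbar : X) (ybar : Y) (hxy : A xbar = ybar)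
    (R : X → EReal) (σR : ℝ) (hAR : DualDescent.AssumptionAR R σR xbar)
    (D J φ : Y → Y → EReal) (σψ p : ℝ) (m : ℝ → EReal)
    (hAD : DualDescent.AssumptionAD D J φ σψ ybar p m)
    (lam : ℕ → ℝ) (τ : ℝ) (x : ℕ → X) (w u : ℕ → Y)
    (hit : DualDescent.IsDiagonalDualDescent R σR A J φ σψ ybar lam τ x w u)
    -- `(ENNReal.ofReal (p - 1))⁻¹` is `1 / (p - 1)`, read as `∞` when `p = 1`
    (hlam : Memℓp lam (ENNReal.ofReal (p - 1))⁻¹) :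
    ∃ xd : X,
      -- `xd` is the unique solution of the primal problem
      (∀ z, DualDescent.IsPrimalSolution R D A ybar z ↔ z = xd) ∧
      [DualDescent.SourceCondition R A xd,
        ∃ ud, DualDescent.IsDualSolution R A ybar ud,
        Bornology.IsBounded (Set.range u)].TFAE ∧
      ((DualDescent.SourceCondition R A xd ∨
          (∃ ud, DualDescent.IsDualSolution R A ybar ud) ∨
          Bornology.IsBounded (Set.range u)) →
        (∃ uinf, DualDescent.IsDualSolution R A ybar uinf ∧
          Filter.Tendsto (fun n => toWeakSpace ℝ Y (u n)) Filter.atTop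
            (nhds (toWeakSpace ℝ Y uinf))) ∧
        (Filter.Tendsto x Filter.atTop (nhds xd) ∧
          (fun n => ‖x n - xd‖) =o[Filter.atTop] fun n : ℕ => (n : ℝ) ^ (-(1 / 2) : ℝ)) ∧
        ∀ ud, DualDescent.IsDualSolution R A ybar ud →
          ∀ N : ℕ, ‖ud‖ * lam N ∈ interior {t : ℝ | DualDescent.conj m t < ⊤} →
            -- the terms of the series are finite and the series converges
            (∀ n, N ≤ n → 0 ≤ DualDescent.conj m (‖ud‖ * lam n) ∧
              DualDescent.conj m (‖ud‖ * lam n) < ⊤) ∧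
            Summable (fun k : ℕ => 2 / (σR * lam (N + k)) *
              (DualDescent.conj m (‖ud‖ * lam (N + k))).toReal) ∧
            ∀ n, N < n → ‖x n - xd‖ ≤
              √(1 / (τ * σR) * ‖u N - ud‖ ^ 2 +
                ∑' k : ℕ, 2 / (σR * lam (N + k)) *
                  (DualDescent.conj m (‖ud‖ * lam (N + k))).toReal) /
              √((n : ℝ) - N)) := by
  have hσ := hAR.σR_pos
  have hτ := hit.τ_pos
  have hs := fun v => hAR.strongly_convex.exists_supportsAt hσ v
  obtain ⟨xd, r, hA, hr, hmin⟩ := hAR.exists_constrained_minimizer A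
  rw [hxy] at hA
  simp only [hxy] at hmin
  obtain ⟨a, ha, hda, hfejer⟩ := exists_dual_values hσ hs hAD hit
  obtain ⟨⟨hm, hmnn, -⟩, ε, γ, hε, hγ, hloc⟩ := hAD.conditioned
  have hm0 := hAD.modulus_zero
  -- Where the conjugate is infinite `toReal` gives 0; the energy inequality is used only at indices
  -- where it is finite.
  set e : Y → ℕ → ℝ := fun z n => (lam n)⁻¹ * (DualDescent.conj m (‖z‖ * lam n)).toReal with he
  have henn : ∀ z n, 0 ≤ e z n := fun z n =>
    mul_nonneg (inv_nonneg.2 (hit.lam_pos n).le) (EReal.toReal_nonneg (conj_nonneg_of_zero hm0 _))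
  have herr := fun z : Y => eventually_finite_and_summable_conj hm hmnn hm0 hε hγ hAD.one_le_p hloc
    hit.lam_pos hit.lam_tendsto hlam (norm_nonneg z)
  have hfej : ∀ z, ∀ᶠ n in atTop, ‖u (n + 1) - z‖ ^ 2 + 2 * τ * (a n - dualReal R A ybar z) ≤
      ‖u n - z‖ ^ 2 + 2 * τ * e z n := fun z =>
    (herr z).1.mono fun n hn => hfejer n z hn
  -- No dual solution is assumed. The affine minorant of the dual objective at z supplies weak lower
  -- semicontinuity.
  have hclus : ∀ (𝒰 : Ultrafilter ℕ), ↑𝒰 ≤ (atTop : Filter ℕ) → ∀ z : Y,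
      (∀ v, Tendsto (fun n => inner ℝ (u n) v) 𝒰 (𝓝 (inner ℝ z v))) →
      IsDualSolution R A ybar z := by
    intro 𝒰 h𝒰 z hz
    rw [isDualSolution_iff hσ hs]
    refine fun v => le_of_forall_pos_le_add fun δ hδ => ?_
    have h1 : ∀ᶠ n in atTop, dualReal R A ybar (u n) ≤ dualReal R A ybar v + δ := by
      have h := eventually_le_add_of_gap hτ ha (henn v) (herr v).2 (hfej v) hδ
      refine (eventually_map (m := fun n => n + 1)).2 (h.mono fun n hn => ?_) |>.filter_mono ?_
      · exact (hda n).trans hn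
      · rw [map_add_atTop_eq_nat]
    set g := ybar - A (gradConj R (-(ContinuousLinearMap.adjoint A z)))
    have h2 : Tendsto (fun n => dualReal R A ybar z + inner ℝ g (u n - z)) 𝒰
        (𝓝 (dualReal R A ybar z)) := by
      have h := ((hz g).sub_const (inner ℝ z g)).const_add (dualReal R A ybar z)
      rw [sub_self, add_zero] at h
      refine h.congr fun n => ?_
      rw [← inner_sub_left, real_inner_comm]
    refine le_of_tendsto h2 ((h1.filter_mono h𝒰).mono fun n hn => ?_)
    exact (dualReal_ge_linear hσ hs z (u n)).trans hn
  have hle : ∀ ud, IsDualSolution R A ybar ud → ∀ n, dualReal R A ybar ud ≤ a n :=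
    fun ud hud n => ((isDualSolution_iff hσ hs ud).1 hud _).trans (hda n)
  have hdist : ∀ ud, IsDualSolution R A ybar ud →
      ∃ l, Tendsto (fun n => ‖u n - ud‖ ^ 2) atTop (𝓝 l) := by
    intro ud hud
    obtain ⟨N, hN⟩ := eventually_atTop.1 (hfej ud)
    refine exists_tendsto_of_quasi_decreasing (e := fun n => 2 * τ * e ud n) (N := N)
      (fun n => sq_nonneg _) (fun n => mul_nonneg (by positivity) (henn ud n))
      ((herr ud).2.mul_left (2 * τ)) fun n hn => ?_
    have h1 := mul_nonneg (by positivity : 0 ≤ 2 * τ) (sub_nonneg.2 (hle ud hud n))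
    linarith [hN n hn]
  have hsrc := sourceCondition_iff_exists_isDualSolution hσ hs hA hr hmin
  have hbdd : (∃ ud, IsDualSolution R A ybar ud) → Bornology.IsBounded (Set.range u) := by
    rintro ⟨ud, hud⟩
    obtain ⟨l, hl⟩ := hdist ud hud
    exact isBounded_range_of_tendsto_sq_dist hl
  have hexists : Bornology.IsBounded (Set.range u) → ∃ ud, IsDualSolution R A ybar ud := by
    intro h
    obtain ⟨B, hB⟩ := isBounded_iff_forall_norm_le.1 h
    obtain ⟨z, hz⟩ := exists_weak_limit_ultrafilter (fun n => hB _ ⟨n, rfl⟩) (hyperfilter ℕ)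
    exact ⟨z, hclus _ Nat.hyperfilter_le_atTop z hz⟩
  have hgap : ∀ ud, IsDualSolution R A ybar ud → ∀ n,
      σR / 2 * ‖x (n + 1) - xd‖ ^ 2 ≤ a n - dualReal R A ybar ud := by
    intro ud hud n
    have h1 := sq_dist_le_dual_gap hσ hs hA hr (u (n + 1))
    have h2 := dualReal_eq_of_supportsAt hσ.le hA
      (supportsAt_of_isDualSolution hσ hs hr hmin hA hud)
    rw [hit.x_eq]
    linarith [hda n]
  refine ⟨xd, isPrimalSolution_iff hσ hAD hA hr hmin, ?_, fun hor => ?_⟩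
  · tfae_have 1 ↔ 2 := hsrc
    tfae_have 2 → 3 := hbdd
    tfae_have 3 → 2 := hexists
    tfae_finish
  have hex : ∃ ud, IsDualSolution R A ybar ud := by
    rcases hor with h | h | h
    exacts [hsrc.1 h, h, hexists h]
  have hrate : (fun n => ‖x n - xd‖) =o[atTop] fun n : ℕ => (n : ℝ) ^ (-(1 / 2) : ℝ) := by
    obtain ⟨ud, hud⟩ := hex
    have hsg := summable_gap hτ (hle ud hud) (henn ud) (herr ud).2 (hfej ud)
    have h1 := tendsto_mul_zero_of_antitone_summable
      (fun i j hij => sub_le_sub_right (ha hij) _) (fun n => sub_nonneg.2 (hle ud hud n)) hsg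
    -- The n-th gap controls x_{n+1}, so the factor needed is n + 1 rather than n.
    have h2 := (h1.add hsg.tendsto_atTop_zero).const_mul (2 / σR)
    rw [add_zero, mul_zero] at h2
    refine isLittleO_rpow_of_tendsto_mul_sq (fun n => norm_nonneg _)
      ((tendsto_add_atTop_iff_nat 1).1 (squeeze_zero (fun n => by positivity) (fun n => ?_) h2))
    have h3 := mul_le_mul_of_nonneg_left (hgap ud hud n)
      (by positivity : 0 ≤ 2 / σR * ((n : ℝ) + 1))
    have e1 : 2 / σR * ((n : ℝ) + 1) * (σR / 2 * ‖x (n + 1) - xd‖ ^ 2) =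
        ((n : ℝ) + 1) * ‖x (n + 1) - xd‖ ^ 2 := by field_simp
    rw [e1] at h3
    push_cast
    linarith
  refine ⟨?_, ⟨tendsto_of_isLittleO_rpow hrate, hrate⟩, ?_⟩
  · obtain ⟨B, hB⟩ := isBounded_iff_forall_norm_le.1 (hbdd hex)
    exact exists_weak_limit_of_fejer (S := {z | IsDualSolution R A ybar z})
      (fun n => hB _ ⟨n, rfl⟩) hdist hclus
  · intro ud hud N hN
    have hfinN : DualDescent.conj m (‖ud‖ * lam N) < ⊤ := by simpa using interior_subset hN
    -- m^* is nondecreasing on the nonnegative half-line and λ_n ≤ λ_N, so finiteness propagates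
    -- beyond N.
    have hfin : ∀ n, N ≤ n → DualDescent.conj m (‖ud‖ * lam n) < ⊤ := fun n hn =>
      (conj_le_conj_of_le hmnn hm0 (mul_nonneg (norm_nonneg _) (hit.lam_pos n).le)
        (mul_le_mul_of_nonneg_left (hit.lam_antitone hn) (norm_nonneg _))).trans_lt
        hfinN
    have hterm : ∀ k, 2 / (σR * lam (N + k)) *
        (DualDescent.conj m (‖ud‖ * lam (N + k))).toReal = 2 / σR * e ud (N + k) := fun k => by
      simp only [he]
      have := (hit.lam_pos (N + k)).ne'
      field_simp
    have hsum : Summable fun k => e ud (N + k) := by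
      simpa only [add_comm N] using (summable_nat_add_iff N).2 (herr ud).2
    refine ⟨fun n hn => ⟨conj_nonneg_of_zero hm0 _, hfin n hn⟩, ?_, fun n hn => ?_⟩
    · simp only [hterm]
      exact hsum.mul_left _
    -- Writing n = N + k + 1, the gap with index N + k controls x_n, and the k + 1 gaps starting at
    -- N give the factor n - N.
    · obtain ⟨k, rfl⟩ := Nat.exists_eq_add_of_lt hn
      simp only [hterm]
      rw [tsum_mul_left]
      have h1 := mul_gap_le_tsum hτ ha (henn ud) (herr ud).2
        (fun n hn => hfejer n ud (hfin n hn)) k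
      have h2 := mul_le_mul_of_nonneg_left (hgap ud hud (N + k))
        (by positivity : 0 ≤ (k : ℝ) + 1)
      have h3 := mul_le_mul_of_nonneg_left (h2.trans h1) (by positivity : 0 ≤ 2 / σR)
      have e1 : 2 / σR * (((k : ℝ) + 1) * (σR / 2 * ‖x (N + k + 1) - xd‖ ^ 2)) =
          ‖x (N + k + 1) - xd‖ ^ 2 * ((k : ℝ) + 1) := by field_simp
      have e2 : 2 / σR * (1 / (2 * τ) * ‖u N - ud‖ ^ 2 + ∑' i, e ud (N + i)) =
          1 / (τ * σR) * ‖u N - ud‖ ^ 2 + 2 / σR * ∑' i, e ud (N + i) := by field_simp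
      rw [e1, e2, ← le_div_iff₀ (by positivity)] at h3
      have e3 : ((N + k + 1 : ℕ) : ℝ) - N = (k : ℝ) + 1 := by push_cast; ring
      rw [e3, ← Real.sqrt_div' _ (by positivity)]
      exact Real.le_sqrt_of_sq_le h3
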